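/- **Setting.** Let $N\ge 0$ be an integer, $\gamma\in\mathbb R$ and $\mu\in\mathbb C$. For $n\ge 0$ put $\mathbb R^n_{\rm reg}=\{x\in\mathbb R^n: x_j\neq x_k \text{ for } j\ne k\}$, $\mathbb R^n_+=\{x\in\mathbb R^n: x_1>\dots>x_n\}$ and $$\mathcal{CB}^\infty(\mathbb R^n)=\{f\in\mathcal C(\mathbb R^n): f|_{\mathbb R^n_{\rm reg}}\in \mathcal C^\infty(\mathbb R^n_{\rm reg})\}$$ (all functions are complex-valued). The symmetric group $S_n$ acts on functions by $(wf)(x_1,\dots,x_n)=f(x_{w(1)},\dots,x_{w(n)})$. For the simple transposition $s_j=(j\;j{+}1)$ put $s_{j,\gamma}=s_j+\gamma I_{j,j+1}$, where $$(I_{jk}f)(x)=\int_0^{x_j-x_k} f\bigl(x-y(e_j-e_k)\bigr)\,dy ,$$ and for $w=s_{i_1}\cdots s_{i_l}\in S_n$ put $w_\gamma=s_{i_1,\gamma}\cdots s_{i_l,\gamma}$. The propagation operator $P^{(n)}_\gamma$ is given on $\mathbb R^n_{\rm reg}$ by $$P^{(n)}_\gamma=\sum_{w\in S_n} w^{-1}\chi_{\mathbb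 R^n_+}w_\gamma$$ ($\chi_{\mathbb R^n_+}$ is multiplication by the indicator function) and is extended to $\mathbb R^n$ by continuity. The free creation operator is $(\hat e^-_\mu f)(x_1,\dots,x_{N+1})=e^{i\mu x_{N+1}}f(x_1,\dots,x_N)$. The non-symmetric creation operator is $$(b^-_\mu f)(x_1,\dots,x_{N+1})=\sum_{n=0}^N\gamma^n\sum_{i_1,\dots,i_n}\theta(x_{N+1}>x_{i_1}>\dots>x_{i_n})\,e^{i\mu x_{N+1}}\Bigl(\prod_{m=1}^n\int_{x_{i_m}}^{x_{i_{m-1}}}dy_m\,e^{i\mu(x_{i_m}-y_m)}\Bigr) f(x_1,\dots,x_N)\big|_{x_{i_1}\to y_1,\dots,x_{i_n}\to y_n},$$ where the inner sum is over $n$-tuples of distinct elements of $\{1,\dots,N\}$, $\theta(\cdot)$ is $1$ if the condition holds and $0$ otherwise, and $x_{i_0}=x_{N+1}$. For $\lambda\in\mathbb C^n$ let $e^{i\lambda}(x)=e^{i\sum_j\lambda_jx_j}$, and let $\psi_\lambda=P^{(n)}_\gamma e^{i\lambda}$ be the pre-wavefunction. **Proposition.** 1. On continuous functions $w_\gamma$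 does not depend on the decomposition of $w$. The operators above are well-defined linear maps $P_\gamma^{(N)}:\mathcal C(\mathbb R^N)\to\mathcal C(\mathbb R^N)$, $P_\gamma^{(N+1)}:\mathcal C(\mathbb R^{N+1})\to\mathcal C(\mathbb R^{N+1})$ and $\hat e^-_\mu,b^-_\mu:\mathcal C(\mathbb R^N)\to\mathcal C(\mathbb R^{N+1})$, and $$P^{(N+1)}_\gamma\,\hat e^-_\mu=b^-_\mu\,P^{(N)}_\gamma\qquad\text{in } \mathrm{Hom}\bigl(\mathcal C(\mathbb R^N),\mathcal C(\mathbb R^{N+1})\bigr).$$ 2. In particular, this identity holds on $\mathcal{CB}^\infty(\mathbb R^N)$; moreover $\hat e^-_\mu$ maps $\mathcal{CB}^\infty(\mathbb R^N)$ into $\mathcal{CB}^\infty(\mathbb R^{N+1})$. 3. If $f\in\mathcal C^\infty(\mathbb R^N)$, then $P^{(N)}_\gamma f\in\mathcal{CB}^\infty(\mathbb R^N)$ and both $P^{(N+1)}_\gamma\hat e^-_\mu f$ and $b^-_\mu P^{(N)}_\gamma f$ lie in $\mathcal{CB}^\infty(\mathbb R^{N+1})$. 4. For every $\lambda\in\mathbb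 C^N$, $\;P^{(N+1)}_\gamma\hat e^-_\mu e^{i\lambda}=\psi_{\lambda,\mu}=b^-_\mu P^{(N)}_\gamma e^{i\lambda}$. -/

import Mathlib

open scoped ContDiff

noncomputable section

namespace QNLS

/-- The transposition `s_j` of two neighbouring coordinates (`j` ranges over `0, …, N - 2`). -/
def simpleRefl {N : ℕ} (j : Fin (N - 1)) : Equiv.Perm (Fin N) :=
  Equiv.swap ⟨j, by omega⟩ ⟨j + 1, by omega⟩

/-- Every permutation has a decomposition into simple transpositions. -/
theorem exists_word {N : ℕ} (w : Equiv.Perm (Fin N)) :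
    ∃ l : List (Fin (N - 1)), (l.map simpleRefl).prod = w := by
  cases N with
  | zero => exact ⟨[], Subsingleton.elim _ _⟩
  | succ n =>
    have h : w ∈ Submonoid.closure
        (Set.range fun i : Fin n ↦ Equiv.swap i.castSucc i.succ) := by
      rw [Equiv.Perm.mclosure_swap_castSucc_succ]; trivial
    induction h using Submonoid.closure_induction with
    | mem x hx =>
      obtain ⟨i, rfl⟩ := hx
      refine ⟨[i], ?_⟩
      simp only [List.map_cons, List.map_nil, List.prod_cons, List.prod_nil, mul_one]
      rfl
    | one => exact ⟨[], rfl⟩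
    | mul x y _ _ hx hy =>
      obtain ⟨l, rfl⟩ := hx
      obtain ⟨m, rfl⟩ := hy
      exact ⟨l ++ m, by simp⟩

/-- The set of regular vectors: all coordinates are distinct. -/
def regular (N : ℕ) : Set (Fin N → ℝ) := {x | Function.Injective x}

/-- The fundamental alcove `x_1 > x_2 > ⋯ > x_N`. -/
def alcove (N : ℕ) : Set (Fin N → ℝ) := {x | StrictAnti x}

/-- Continuous functions whose restriction to the regular vectors is smooth. -/
def CBSmooth (N : ℕ) : Set ((Fin N → ℝ) → ℂ) :=
  {f | Continuous f ∧ ContDiffOn ℝ ∞ f (regular N)}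

/-- The left action of the symmetric group on functions,
`(w f)(x_1, …, x_N) = f (x_{w 1}, …, x_{w N})`. -/
def permAct {N : ℕ} (w : Equiv.Perm (Fin N)) (f : (Fin N → ℝ) → ℂ) : (Fin N → ℝ) → ℂ :=
  fun x ↦ f (x ∘ w)

/-- `(I_{j k} f)(x) = ∫_0^{x_j - x_k} f (x - y (e_j - e_k)) dy`. -/
def intOp {N : ℕ} (j k : Fin N) (f : (Fin N → ℝ) → ℂ) : (Fin N → ℝ) → ℂ :=
  fun x ↦ ∫ y in (0 : ℝ)..(x j - x k), f (x - y • (Pi.single j 1 - Pi.single k 1))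

/-- The deformed simple transposition `s_{j,γ} = s_j + γ I_{j, j+1}`. -/
def deformedRefl {N : ℕ} (γ : ℝ) (j : Fin (N - 1)) (f : (Fin N → ℝ) → ℂ) :
    (Fin N → ℝ) → ℂ :=
  fun x ↦ permAct (simpleRefl j) f x + γ * intOp ⟨j, by omega⟩ ⟨j + 1, by omega⟩ f x

/-- The composition `s_{i_1,γ} ⋯ s_{i_l,γ}` attached to a word `i_1, …, i_l`. -/
def wordOp {N : ℕ} (γ : ℝ) (l : List (Fin (N - 1))) (f : (Fin N → ℝ) → ℂ) :
    (Fin N → ℝ) → ℂ :=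
  l.foldr (fun j g ↦ deformedRefl γ j g) f

/-- The deformed permutation `w_γ`, formed with some decomposition of `w` into simple
transpositions (on continuous functions the result does not depend on the decomposition). -/
def deformedPerm {N : ℕ} (γ : ℝ) (w : Equiv.Perm (Fin N)) (f : (Fin N → ℝ) → ℂ) :
    (Fin N → ℝ) → ℂ :=
  wordOp γ (exists_word w).choose f

/-- `∑_w w⁻¹ χ_{ℝ^N_+} w_γ`, which is the propagation operator on the regular vectors. -/
def propagationReg {N : ℕ} (γ : ℝ) (f : (Fin N → ℝ) → ℂ) : (Fin N → ℝ) → ℂ :=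
  fun x ↦ ∑ w : Equiv.Perm (Fin N),
    permAct w⁻¹ ((alcove N).indicator (deformedPerm γ w f)) x

/-- The propagation operator `P_γ^{(N)}`: the formula on the regular vectors, extended
to all of `ℝ^N` by taking limits along regular vectors. -/
def propagation {N : ℕ} (γ : ℝ) (f : (Fin N → ℝ) → ℂ) : (Fin N → ℝ) → ℂ :=
  extendFrom (regular N) (propagationReg γ f)

/-- The free creation operator
`(ê⁻_μ f)(x_1, …, x_{N+1}) = e^{i μ x_{N+1}} f(x_1, …, x_N)`. -/
def freeCreation {N : ℕ} (μ : ℂ) (f : (Fin N → ℝ) → ℂ) : (Fin (N + 1) → ℝ) → ℂ :=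
  fun x ↦ Complex.exp (Complex.I * μ * x (Fin.last N)) * f (Fin.init x)

/-- The iterated integral `∏_m ∫_{x_{i_m}}^{x_{i_{m-1}}} dy_m e^{i μ (x_{i_m} - y_m)}` of
`f (φ_{i → y} z)`, where `x_{i_0} = a` and `φ_{i → y}` replaces the coordinate `i_m` by `y_m`. -/
def iterInt {N : ℕ} (μ : ℂ) (x : Fin N → ℝ) (f : (Fin N → ℝ) → ℂ) :
    List (Fin N) → ℝ → (Fin N → ℝ) → ℂ
  | [], _, z => f z
  | i :: l, a, z => ∫ y in (x i)..a,
      Complex.exp (Complex.I * μ * ((x i : ℂ) - y)) *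
        iterInt μ x f l (x i) (Function.update z i y)

open Classical in
/-- The elementary integral operator `ê⁻_{μ; i_1 … i_n}`, for distinct `i_1, …, i_n`; the
condition in the `if` is `x_{N+1} > x_{i_1} > ⋯ > x_{i_n}`. -/
def elemCreation {N n : ℕ} (μ : ℂ) (i : Fin n ↪ Fin N) (f : (Fin N → ℝ) → ℂ) :
    (Fin (N + 1) → ℝ) → ℂ :=
  fun x ↦
    if StrictAnti (Fin.cons (x (Fin.last N)) (fun m ↦ Fin.init x (i m)) : Fin (n + 1) → ℝ) then
      Complex.exp (Complex.I * μ * x (Fin.last N)) *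
        iterInt μ (Fin.init x) f (List.ofFn i) (x (Fin.last N)) (Fin.init x)
    else 0

/-- The non-symmetric creation operator
`b⁻_μ = ∑_{n = 0}^N γ^n ∑_{i_1, …, i_n distinct} ê⁻_{μ; i_1 … i_n}`. -/
def creation {N : ℕ} (γ : ℝ) (μ : ℂ) (f : (Fin N → ℝ) → ℂ) : (Fin (N + 1) → ℝ) → ℂ :=
  fun x ↦ ∑ n ∈ Finset.range (N + 1),
    (γ : ℂ) ^ n * ∑ i : Fin n ↪ Fin N, elemCreation μ i f x

/-- The plane wave `x ↦ e^{i ⟨λ, x⟩}`. -/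
def planeWave {N : ℕ} (lam : Fin N → ℂ) : (Fin N → ℝ) → ℂ :=
  fun x ↦ Complex.exp (Complex.I * ∑ j, lam j * x j)

/-- The pre-wavefunction `ψ_λ = P_γ e^{iλ}`. -/
def preWave {N : ℕ} (γ : ℝ) (lam : Fin N → ℂ) : (Fin N → ℝ) → ℂ :=
  propagation γ (planeWave lam)

end QNLS

end

/-! The proof has two halves: the operators make sense, and both sides of the intertwining relation
solve the same integral equation.

Well-definedness rests on the relation of the degenerate affine Hecke algebra: `∂_m s_{i,γ} =
s_{i,γ} ∂_{s_i m} + γ c`, with `c ∈ {0, 1, -1}` (`partialDeriv_deformedRefl`). Moving `∂_j` through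
a word therefore produces words with one letter deleted, and the total coefficient of each resulting
permutation depends only on the product of the word (`deletionSum_eq`). By induction on length, two
words for the same `w`, applied to a plane wave, differ by a joint eigenfunction of all `∂_j` that
vanishes at `0`, hence by `0` (`wordOp_planeWave_eq`). Trigonometric polynomials are dense for
compact convergence, which gives the claim on all continuous functions. If a permutation fixes a
point `x` of the closed alcove, its deformation does not change values at `x`. So the pieces of
`P_γ` glue, and its formula holds on every closed chamber (`propagation_apply`).

For the intertwining relation, write `t` for the last coordinate and `x` for the others. Put `h =
P_γ f`, and let `F(x, t)` be either side. Then `F(x, t) = e^{iμt} h(x) + γ ∑_i ∫_{x_i}^{max(t, x_i)}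
e^{iμ(t-y)} F(x with x_i → y, x_i) dy`. For `b⁻_μ P_γ f` this splits off the first index of each
tuple (`creationAt_recursion`). For `P_γ ê⁻_μ f` with `f` smooth, it is a first-order equation in
`t` coming from the commutation rule, with initial value at `t` below all `x_i`
(`propagation_freeCreation_recursion`). The equation has at most one solution, since each integral
lowers the number of coordinates below `t` (`eq_of_creation_recursion`). Density extends the result
from plane waves to continuous functions. -/

namespace QNLS

/-! ### Differentiating the integral operators `I_{jk}` -/

section Integral

variable {n : ℕ}

theorem hasFDerivAt_intervalIntegral_of_continuous {F : (Fin n → ℝ) → ℝ → ℂ}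
    {F' : (Fin n → ℝ) → ℝ → (Fin n → ℝ) →L[ℝ] ℂ}
    (hF : Continuous (Function.uncurry F)) (hF' : Continuous (Function.uncurry F'))
    (h : ∀ x t, HasFDerivAt (fun x ↦ F x t) (F' x t) x) (a b : ℝ) (x : Fin n → ℝ) :
    HasFDerivAt (fun x ↦ ∫ t in a..b, F x t) (∫ t in a..b, F' x t) x := by
  obtain ⟨C, hC⟩ := ((isCompact_closedBall x 1).prod (isCompact_uIcc (a := a) (b := b))
    ).exists_bound_of_continuousOn hF'.continuousOn
  refine intervalIntegral.hasFDerivAt_integral_of_dominated_of_fderiv_le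
    (s := Metric.closedBall x 1) (bound := fun _ ↦ C) (Metric.closedBall_mem_nhds x one_pos)
    (.of_forall fun x ↦ ?_) ?_ ?_ ?_ ?_ ?_
  · exact (hF.uncurry_left x).aestronglyMeasurable
  · exact (hF.uncurry_left x).intervalIntegrable _ _
  · exact (hF'.uncurry_left x).aestronglyMeasurable
  · exact .of_forall fun t ht y hy ↦ hC (y, t) ⟨hy, Set.uIoc_subset_uIcc ht⟩
  · exact intervalIntegrable_const
  · exact .of_forall fun t _ y _ ↦ h y t

theorem intOp_eq_unitInterval (j k : Fin n) (f : (Fin n → ℝ) → ℂ) (x : Fin n → ℝ) :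
    intOp j k f x = ∫ t in (0 : ℝ)..1,
      (x j - x k) • f (x - ((x j - x k) * t) • (Pi.single j 1 - Pi.single k 1)) := by
  rw [intervalIntegral.integral_smul, intOp]
  have := intervalIntegral.smul_integral_comp_mul_left (a := 0) (b := 1)
    (fun y ↦ f (x - y • (Pi.single j 1 - Pi.single k 1))) (x j - x k)
  rw [this]; simp

theorem hasFDerivAt_intOp (j k : Fin n) {f : (Fin n → ℝ) → ℂ} (hf : ContDiff ℝ 1 f)
    (x : Fin n → ℝ) : DifferentiableAt ℝ (intOp j k f) x ∧ ∀ u, fderiv ℝ (intOp j k f) x u =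
      (u j - u k) • f (x - (x j - x k) • (Pi.single j 1 - Pi.single k 1)) +
        intOp j k (fun z ↦ fderiv ℝ f z u) x := by
  set v : Fin n → ℝ := Pi.single j 1 - Pi.single k 1 with hv
  set a : (Fin n → ℝ) →L[ℝ] ℝ :=
    (ContinuousLinearMap.proj j : (Fin n → ℝ) →L[ℝ] ℝ) - ContinuousLinearMap.proj k with ha
  have hax (y : Fin n → ℝ) : y j - y k = a y := rfl
  have hdf := hf.differentiable one_ne_zero
  have hcf := hf.continuous
  have hcf' := hf.continuous_fderiv one_ne_zero
  let F (x : Fin n → ℝ) (t : ℝ) : ℂ := a x • f (x - (a x * t) • v)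
  let G (x : Fin n → ℝ) (t : ℝ) : (Fin n → ℝ) →L[ℝ] ℂ :=
    a x • (fderiv ℝ f (x - (a x * t) • v)).comp
      (ContinuousLinearMap.id ℝ _ - (t • a).smulRight v) + a.smulRight (f (x - (a x * t) • v))
  have hFG (x : Fin n → ℝ) (t : ℝ) : HasFDerivAt (fun x ↦ F x t) (G x t) x := by
    have h1 : HasFDerivAt (fun x : Fin n → ℝ ↦ x - (a x * t) • v)
        (ContinuousLinearMap.id ℝ _ - (t • a).smulRight v) x :=
      (hasFDerivAt_id x).sub ((a.hasFDerivAt.mul_const t).smul_const v)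
    exact a.hasFDerivAt.smul ((hdf _).hasFDerivAt.comp x h1)
  have hG : Continuous (Function.uncurry G) := by
    simp only [G, Function.uncurry_def]
    have h1 : Continuous fun p : (Fin n → ℝ) × ℝ ↦ fderiv ℝ f (p.1 - (a p.1 * p.2) • v) :=
      hcf'.comp (by fun_prop)
    have h2 : Continuous fun p : (Fin n → ℝ) × ℝ ↦ (p.2 • a).smulRight v :=
      ((ContinuousLinearMap.smulRightL ℝ (Fin n → ℝ) (Fin n → ℝ)).flip v).continuous.comp
        (f := fun p : (Fin n → ℝ) × ℝ ↦ p.2 • a) (by fun_prop)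
    have h3 : Continuous fun p : (Fin n → ℝ) × ℝ ↦ f (p.1 - (a p.1 * p.2) • v) := by fun_prop
    have h4 : Continuous fun p : (Fin n → ℝ) × ℝ ↦ a.smulRight (f (p.1 - (a p.1 * p.2) • v)) :=
      (ContinuousLinearMap.smulRightL ℝ (Fin n → ℝ) ℂ a).continuous.comp h3
    have h5 : Continuous fun p : (Fin n → ℝ) × ℝ ↦ a p.1 := by fun_prop
    exact .add (h5.smul (h1.clm_comp (continuous_const.sub h2))) h4
  have key := hasFDerivAt_intervalIntegral_of_continuous (F := F) (F' := G)
    (by simp only [F, Function.uncurry_def]; fun_prop) hG hFG 0 1 x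
  have hI : intOp j k f = fun x ↦ ∫ t in (0 : ℝ)..1, F x t :=
    funext fun x ↦ intOp_eq_unitInterval j k f x
  rw [← hI] at key
  refine ⟨key.differentiableAt, fun u ↦ ?_⟩
  rw [key.fderiv, ContinuousLinearMap.intervalIntegral_apply
    ((hG.uncurry_left x).intervalIntegrable _ _), intOp_eq_unitInterval]
  -- The terms containing `a u` form the exact `t`-derivative of `a u • (t • f (x - (a x * t) •
  -- v))`. Its increment over `[0, 1]` is the boundary term.
  have hu (t : ℝ) : G x t u =
      (a u • (t • fderiv ℝ f (x - (a x * t) • v) (-(a x • v)) + (1 : ℝ) • f (x - (a x * t) • v)))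
        + a x • fderiv ℝ f (x - (a x * t) • v) u := by
    simp only [G, add_apply, smul_apply,
      ContinuousLinearMap.comp_apply, sub_apply, ContinuousLinearMap.id_apply,
      ContinuousLinearMap.smulRight_apply, map_sub, map_smul, map_neg, smul_eq_mul,
      Complex.real_smul]
    push_cast; ring
  have hd (t : ℝ) : HasDerivAt (fun t : ℝ ↦ a u • (t • f (x - (a x * t) • v)))
      (a u • (t • fderiv ℝ f (x - (a x * t) • v) (-(a x • v)) + (1 : ℝ) • f (x - (a x * t) • v)))
      t := by
    have h1 : HasDerivAt (fun t : ℝ ↦ x - (a x * t) • v) (-(a x • v)) t := by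
      simpa using (((hasDerivAt_id t).const_mul (a x)).smul_const v).const_sub x
    exact ((hasDerivAt_id t).smul ((hdf _).hasFDerivAt.comp_hasDerivAt t h1)).const_smul (a u)
  simp_rw [hu]
  rw [intervalIntegral.integral_add, intervalIntegral.integral_eq_sub_of_hasDerivAt
    (fun t _ ↦ hd t)]
  · simp [hax, hv]
  all_goals
    apply Continuous.intervalIntegrable
    have h1 (w : Fin n → ℝ) : Continuous fun t : ℝ ↦ fderiv ℝ f (x - (a x * t) • v) w :=
      (hcf'.comp (f := fun t : ℝ ↦ x - (a x * t) • v) (by fun_prop)).clm_apply continuous_const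
    fun_prop

/-- Each directional derivative of `I_{jk} f` is a multiple of `f` composed with a linear map, plus
`I_{jk}` of a derivative of `f`, so smoothness follows by induction on the order. -/
theorem contDiff_intOp (j k : Fin n) {f : (Fin n → ℝ) → ℂ} (hf : ContDiff ℝ ∞ f) :
    ContDiff ℝ ∞ (intOp j k f) := by
  rw [contDiff_infty]
  intro m
  induction m generalizing f with
  | zero =>
    exact contDiff_zero.2 <| Differentiable.continuous (𝕜 := ℝ) fun x ↦
      (hasFDerivAt_intOp j k (hf.of_le (by simp)) x).1
  | succ m ih =>
    have h1 := hasFDerivAt_intOp j k (hf.of_le (by simp) : ContDiff ℝ 1 f)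
    push_cast
    rw [contDiff_succ_iff_fderiv_apply]
    refine ⟨fun x ↦ (h1 x).1, by simp, fun u ↦ ?_⟩
    simp_rw [fun x ↦ (h1 x).2 u]
    refine .add (.const_smul _ ?_) (ih ?_)
    · exact (hf.of_le (mod_cast le_top)).comp (by fun_prop)
    · exact (hf.fderiv_right le_rfl).clm_apply contDiff_const

end Integral

/-! ### Deformed transpositions and their commutation with derivatives -/

section DeformedReflection

variable {n : ℕ} {S : Type*} [TopologicalSpace S]

theorem continuous_intOp (j k : Fin n) {F : S → (Fin n → ℝ) → ℂ}
    (hF : Continuous fun p : S × (Fin n → ℝ) ↦ F p.1 p.2) :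
    Continuous fun p : S × (Fin n → ℝ) ↦ intOp j k (F p.1) p.2 := by
  unfold intOp
  refine intervalIntegral.continuous_parametric_intervalIntegral_of_continuous ?_ (by fun_prop)
  exact hF.comp (f := fun q : (S × (Fin n → ℝ)) × ℝ ↦
    (q.1.1, q.1.2 - q.2 • (Pi.single j 1 - Pi.single k 1))) (by fun_prop)

theorem continuous_deformedRefl (γ : ℝ) (j : Fin (n - 1)) {F : S → (Fin n → ℝ) → ℂ}
    (hF : Continuous fun p : S × (Fin n → ℝ) ↦ F p.1 p.2) :
    Continuous fun p : S × (Fin n → ℝ) ↦ deformedRefl γ j (F p.1) p.2 := by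
  unfold deformedRefl permAct
  refine .add (hF.comp (f := fun p : S × (Fin n → ℝ) ↦ (p.1, p.2 ∘ simpleRefl j)) ?_)
    (continuous_const.mul (continuous_intOp _ _ hF))
  refine continuous_fst.prodMk (continuous_pi fun i ↦ ?_)
  exact (continuous_apply _).comp continuous_snd

theorem continuous_wordOp (γ : ℝ) (l : List (Fin (n - 1))) {F : S → (Fin n → ℝ) → ℂ}
    (hF : Continuous fun p : S × (Fin n → ℝ) ↦ F p.1 p.2) :
    Continuous fun p : S × (Fin n → ℝ) ↦ wordOp γ l (F p.1) p.2 := by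
  induction l with
  | nil => exact hF
  | cons j l ih => exact continuous_deformedRefl γ j (F := fun s ↦ wordOp γ l (F s)) ih

theorem Continuous.wordOp (γ : ℝ) (l : List (Fin (n - 1))) {f : (Fin n → ℝ) → ℂ}
    (hf : Continuous f) : Continuous (QNLS.wordOp γ l f) :=
  (continuous_wordOp (S := Unit) γ l (F := fun _ ↦ f) (hf.comp continuous_snd)).comp
    (Continuous.prodMk_right ())

theorem intOp_add (j k : Fin n) {f g : (Fin n → ℝ) → ℂ} (hf : Continuous f) (hg : Continuous g) :
    intOp j k (f + g) = intOp j k f + intOp j k g := by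
  ext x
  exact intervalIntegral.integral_add (Continuous.intervalIntegrable (by fun_prop) _ _)
    (Continuous.intervalIntegrable (by fun_prop) _ _)

theorem intOp_smul (j k : Fin n) (c : ℂ) (f : (Fin n → ℝ) → ℂ) :
    intOp j k (c • f) = c • intOp j k f := by
  ext x
  exact intervalIntegral.integral_smul c _

theorem deformedRefl_add (γ : ℝ) (j : Fin (n - 1)) {f g : (Fin n → ℝ) → ℂ}
    (hf : Continuous f) (hg : Continuous g) :
    deformedRefl γ j (f + g) = deformedRefl γ j f + deformedRefl γ j g := by
  ext x
  simp only [deformedRefl, intOp_add _ _ hf hg, permAct, Pi.add_apply]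
  ring

theorem deformedRefl_smul (γ : ℝ) (j : Fin (n - 1)) (c : ℂ) (f : (Fin n → ℝ) → ℂ) :
    deformedRefl γ j (c • f) = c • deformedRefl γ j f := by
  ext x
  simp only [deformedRefl, intOp_smul, permAct, Pi.smul_apply, smul_eq_mul]
  ring

theorem wordOp_add (γ : ℝ) (l : List (Fin (n - 1))) {f g : (Fin n → ℝ) → ℂ}
    (hf : Continuous f) (hg : Continuous g) :
    wordOp γ l (f + g) = wordOp γ l f + wordOp γ l g := by
  induction l with
  | nil => rfl
  | cons j l ih =>
    exact (congrArg (deformedRefl γ j) ih).trans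
      (deformedRefl_add γ j (Continuous.wordOp γ l hf) (Continuous.wordOp γ l hg))

theorem wordOp_smul (γ : ℝ) (l : List (Fin (n - 1))) (c : ℂ) (f : (Fin n → ℝ) → ℂ) :
    wordOp γ l (c • f) = c • wordOp γ l f := by
  induction l with
  | nil => rfl
  | cons j l ih => exact (congrArg (deformedRefl γ j) ih).trans (deformedRefl_smul γ j c _)

theorem contDiff_deformedRefl (γ : ℝ) (j : Fin (n - 1)) {f : (Fin n → ℝ) → ℂ}
    (hf : ContDiff ℝ ∞ f) : ContDiff ℝ ∞ (deformedRefl γ j f) := by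
  refine .add (hf.comp (contDiff_pi.2 fun i ↦ ?_)) (contDiff_const.mul (contDiff_intOp _ _ hf))
  exact contDiff_apply ℝ ℝ _

theorem contDiff_wordOp (γ : ℝ) (l : List (Fin (n - 1))) {f : (Fin n → ℝ) → ℂ}
    (hf : ContDiff ℝ ∞ f) : ContDiff ℝ ∞ (wordOp γ l f) := by
  induction l with
  | nil => exact hf
  | cons j l ih => exact contDiff_deformedRefl γ j ih

/-- The partial derivative of a function in the direction of the coordinate `j`. -/
noncomputable def partialDeriv (j : Fin n) (f : (Fin n → ℝ) → ℂ) : (Fin n → ℝ) → ℂ :=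
  fun x ↦ fderiv ℝ f x (Pi.single j 1)

theorem contDiff_partialDeriv (j : Fin n) {f : (Fin n → ℝ) → ℂ}
    (hf : ContDiff ℝ ∞ f) : ContDiff ℝ ∞ (partialDeriv j f) :=
  (hf.fderiv_right le_rfl).clm_apply contDiff_const

/-- The coefficient of the identity in the commutator of `s_{i,γ}` with partial derivatives. -/
noncomputable def reflCoeff (i : Fin (n - 1)) (m : Fin n) : ℝ :=
  (if m = ⟨i, by omega⟩ then 1 else 0) - (if m = ⟨i + 1, by omega⟩ then 1 else 0)

theorem comp_swap_eq_sub {j k : Fin n} (x : Fin n → ℝ) :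
    x ∘ Equiv.swap j k = x - (x j - x k) • (Pi.single j 1 - Pi.single k 1) := by
  ext i
  simp only [Function.comp_apply, Equiv.swap_apply_def, Pi.sub_apply, Pi.smul_apply,
    Pi.single_apply, smul_eq_mul]
  split_ifs <;> simp_all

theorem single_comp_perm (w : Equiv.Perm (Fin n)) (m : Fin n) :
    (Pi.single m 1 : Fin n → ℝ) ∘ w = Pi.single (w⁻¹ m) 1 := by
  ext i
  simp only [Function.comp_apply, Pi.single_apply, Equiv.Perm.eq_inv_iff_eq]

theorem fderiv_permAct (w : Equiv.Perm (Fin n)) {f : (Fin n → ℝ) → ℂ} (hf : Differentiable ℝ f)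
    (x : Fin n → ℝ) : HasFDerivAt (permAct w f)
      ((fderiv ℝ f (x ∘ w)).comp (ContinuousLinearMap.pi fun i ↦ .proj (w i))) x :=
  (hf (x ∘ w)).hasFDerivAt.comp x
    (ContinuousLinearMap.hasFDerivAt
      (ContinuousLinearMap.pi fun i ↦ .proj (w i) : (Fin n → ℝ) →L[ℝ] Fin n → ℝ))

/-- The fundamental theorem of calculus along the segment from `x` to its reflection. -/
theorem intOp_sub_partialDeriv (j k : Fin n) {f : (Fin n → ℝ) → ℂ} (hf : ContDiff ℝ ∞ f)
    (x : Fin n → ℝ) : intOp j k (partialDeriv j f) x - intOp j k (partialDeriv k f) x =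
      f x - f (x ∘ Equiv.swap j k) := by
  have h1 := fun m ↦ (contDiff_partialDeriv m hf).continuous
  have h2 (y : ℝ) : HasDerivAt (fun y : ℝ ↦ f (x - y • (Pi.single j 1 - Pi.single k 1)))
      (-(partialDeriv j f (x - y • (Pi.single j 1 - Pi.single k 1)) -
        partialDeriv k f (x - y • (Pi.single j 1 - Pi.single k 1)))) y := by
    have h3 : HasDerivAt (fun y : ℝ ↦ x - y • (Pi.single j 1 - Pi.single k 1))
        (-(Pi.single j 1 - Pi.single k 1)) y := by
      have := ((hasDerivAt_id y).smul_const
        (Pi.single j 1 - Pi.single k 1 : Fin n → ℝ)).const_sub x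
      rwa [one_smul] at this
    have h4 := ((hf.differentiable (by simp)) _).hasFDerivAt.comp_hasDerivAt y h3
    rwa [map_neg, map_sub] at h4
  rw [intOp, intOp, ← intervalIntegral.integral_sub, comp_swap_eq_sub, ← neg_inj,
    ← intervalIntegral.integral_neg, intervalIntegral.integral_eq_sub_of_hasDerivAt
      (fun y _ ↦ h2 y)]
  · simp
  all_goals exact Continuous.intervalIntegrable (by fun_prop) _ _

/-- The Hecke relation. Differentiating the upper limit of the integral yields `± f ∘ s_i`, which
`intOp_sub_partialDeriv` trades for `± f` while exchanging the two derivatives under the integral.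
-/
theorem partialDeriv_deformedRefl (γ : ℝ) (i : Fin (n - 1)) (m : Fin n) {f : (Fin n → ℝ) → ℂ}
    (hf : ContDiff ℝ ∞ f) : partialDeriv m (deformedRefl γ i f) =
      deformedRefl γ i (partialDeriv (simpleRefl i m) f) + (γ * reflCoeff i m : ℂ) • f := by
  ext x
  obtain ⟨hd, hI⟩ := hasFDerivAt_intOp ⟨i, by omega⟩ ⟨i + 1, by omega⟩
    (hf.of_le (by simp) : ContDiff ℝ 1 f) x
  have h := (fderiv_permAct (simpleRefl i) (hf.differentiable (by simp)) x).add
    (hd.hasFDerivAt.const_mul (γ : ℂ))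
  have h1 : partialDeriv m (deformedRefl γ i f) x =
      partialDeriv ((simpleRefl i)⁻¹ m) f (x ∘ simpleRefl i) + γ * _ :=
    (DFunLike.congr_fun h.fderiv (Pi.single m 1)).trans <| by
      simp only [add_apply, smul_apply, smul_eq_mul, ContinuousLinearMap.comp_apply]
      rw [hI, ← comp_swap_eq_sub]
      congr 2
      exact (single_comp_perm (simpleRefl i) m)
  have h2 := intOp_sub_partialDeriv ⟨i, by omega⟩ ⟨i + 1, by omega⟩ hf x
  have h3 : (simpleRefl i)⁻¹ = simpleRefl i := Equiv.swap_inv _ _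
  rw [h1, h3]
  simp only [deformedRefl, permAct, Pi.add_apply, Pi.smul_apply, smul_eq_mul, reflCoeff]
  rw [add_assoc, mul_assoc, ← mul_add]
  congr 2
  change _ + intOp _ _ (partialDeriv m f) x = _
  rcases eq_or_ne m ⟨i, by omega⟩ with rfl | hm
  · simp only [simpleRefl, Equiv.swap_apply_left, Pi.single_apply] at h2 ⊢
    simp
    linear_combination h2
  rcases eq_or_ne m ⟨i + 1, by omega⟩ with rfl | hm'
  · simp only [simpleRefl, Equiv.swap_apply_right, Pi.single_apply] at h2 ⊢
    simp
    linear_combination -h2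
  · rw [simpleRefl, Equiv.swap_apply_of_ne_of_ne hm hm']
    simp [hm, hm', Ne.symm hm, Ne.symm hm']

end DeformedReflection

/-! ### Independence of the word on plane waves -/

section Words

variable {n : ℕ}

/-- The signed sum of `φ` over the words obtained from a word by deleting one letter; the weights
are the coefficients that arise when a partial derivative is moved through the word. -/
noncomputable def deletionSum {M : Type*} [AddCommGroup M] [Module ℂ M] :
    List (Fin (n - 1)) → Fin n → (List (Fin (n - 1)) → M) → M
  | [], _, _ => 0
  | i :: l, j, φ => deletionSum l (simpleRefl i j) (fun m ↦ φ (i :: m)) +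
      (reflCoeff i j : ℂ) • φ l

theorem deletionSum_deformedRefl (γ : ℝ) (i : Fin (n - 1)) (l : List (Fin (n - 1))) (j : Fin n)
    {φ : List (Fin (n - 1)) → (Fin n → ℝ) → ℂ} (hφ : ∀ m, Continuous (φ m)) :
    Continuous (deletionSum l j φ) ∧
    deformedRefl γ i (deletionSum l j φ) = deletionSum l j (fun m ↦ deformedRefl γ i (φ m)) := by
  induction l generalizing j φ with
  | nil =>
    refine ⟨continuous_const, ?_⟩
    simpa [deletionSum] using deformedRefl_smul γ i 0 (0 : (Fin n → ℝ) → ℂ)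
  | cons k l ih =>
    obtain ⟨h1, h2⟩ := ih (simpleRefl k j) (φ := fun m ↦ φ (k :: m)) fun m ↦ hφ _
    have h3 : Continuous ((reflCoeff k j : ℂ) • φ l) := (hφ l).const_smul _
    refine ⟨h1.add h3, ?_⟩
    rw [deletionSum, deformedRefl_add _ _ h1 h3, h2, deformedRefl_smul, deletionSum]

theorem partialDeriv_add (j : Fin n) {f g : (Fin n → ℝ) → ℂ} (hf : ContDiff ℝ ∞ f)
    (hg : ContDiff ℝ ∞ g) : partialDeriv j (f + g) = partialDeriv j f + partialDeriv j g := by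
  ext x
  simp only [partialDeriv]
  rw [fderiv_add ((hf.differentiable (by simp)) x) ((hg.differentiable (by simp)) x)]
  rfl

theorem partialDeriv_wordOp (γ : ℝ) (l : List (Fin (n - 1))) (j : Fin n) {f : (Fin n → ℝ) → ℂ}
    (hf : ContDiff ℝ ∞ f) : partialDeriv j (wordOp γ l f) =
      wordOp γ l (partialDeriv ((l.map simpleRefl).prod⁻¹ j) f) +
        (γ : ℂ) • deletionSum l j (fun m ↦ wordOp γ m f) := by
  induction l generalizing j with
  | nil => simp [wordOp, deletionSum]
  | cons i l ih =>
    have h1 := deletionSum_deformedRefl γ i l (simpleRefl i j)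
      (φ := fun m ↦ wordOp γ m f) fun m ↦ Continuous.wordOp γ m hf.continuous
    have h2 := Continuous.wordOp γ l
      (contDiff_partialDeriv ((l.map simpleRefl).prod⁻¹ (simpleRefl i j)) hf).continuous
    have h3 : ((i :: l).map simpleRefl).prod⁻¹ j = (l.map simpleRefl).prod⁻¹ (simpleRefl i j) := by
      rw [List.map_cons, List.prod_cons, mul_inv_rev, Equiv.Perm.mul_apply]
      rw [show (simpleRefl i)⁻¹ = simpleRefl i from Equiv.swap_inv _ _]
    change partialDeriv j (deformedRefl γ i (wordOp γ l f)) = _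
    rw [partialDeriv_deformedRefl γ i j (contDiff_wordOp γ l hf), ih,
      deformedRefl_add _ _ h2 (h1.1.const_smul _), deformedRefl_smul, h1.2, h3, deletionSum,
      smul_add, smul_smul, add_assoc]
    rfl

/-- The coefficient of `(j k) w` in the commutator of `w_γ` with partial derivatives. -/
noncomputable def inversionCoeff (w : Equiv.Perm (Fin n)) (j k : Fin n) : ℂ :=
  (if j < k then 1 else 0) - (if w⁻¹ j < w⁻¹ k then 1 else 0)

/-- A simple transposition reverses the order of exactly one pair, so at most one summand survives.
This is the one-letter case of the count in `deletionSum_eq`. -/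
theorem sum_order_change {M : Type*} [AddCommGroup M] [Module ℂ M] (i : Fin (n - 1)) (j : Fin n)
    (Ψ : Equiv.Perm (Fin n) → M) :
    ∑ k, ((if j < k then 1 else 0 : ℂ) - (if simpleRefl i j < simpleRefl i k then 1 else 0)) •
      Ψ (Equiv.swap j k * simpleRefl i) = (reflCoeff i j : ℂ) • Ψ 1 := by
  have hs (k : Fin n) : (simpleRefl i k : ℕ) =
      if (k : ℕ) = i then (i : ℕ) + 1 else if (k : ℕ) = i + 1 then (i : ℕ) else k := by
    simp only [simpleRefl, Equiv.swap_apply_def, Fin.ext_iff]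
    split_ifs <;> rfl
  have hi : (i : ℕ) + 1 < n := by omega
  rcases eq_or_ne j ⟨i, by omega⟩ with rfl | hj
  · rw [Finset.sum_eq_single ⟨i + 1, hi⟩]
    · simp [reflCoeff, Fin.lt_def, simpleRefl]
    · intro k _ hk
      have : (k : ℕ) ≠ i + 1 := fun h ↦ hk (Fin.ext h)
      rw [sub_eq_zero.2, zero_smul]
      congr 1
      simp only [Fin.lt_def, hs]
      grind
    · simp
  rcases eq_or_ne j ⟨i + 1, hi⟩ with rfl | hj'
  · rw [Finset.sum_eq_single ⟨i, by omega⟩]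
    · rw [Equiv.swap_comm]
      simp [reflCoeff, Fin.lt_def, simpleRefl]
    · intro k _ hk
      have : (k : ℕ) ≠ i := fun h ↦ hk (Fin.ext h)
      rw [sub_eq_zero.2, zero_smul]
      congr 1
      simp only [Fin.lt_def, hs]
      grind
    · simp
  · have h1 : (j : ℕ) ≠ i := fun h ↦ hj (Fin.ext h)
    have h2 : (j : ℕ) ≠ i + 1 := fun h ↦ hj' (Fin.ext h)
    rw [reflCoeff, if_neg hj, if_neg hj', sub_zero, Complex.ofReal_zero, zero_smul]
    refine Finset.sum_eq_zero fun k _ ↦ ?_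
    rw [sub_eq_zero.2, zero_smul]
    congr 1
    simp only [Fin.lt_def, hs]
    grind

/-- The inversion coefficients satisfy a cocycle identity under left multiplication by `s_i`,
matching the recursion of the deletion sum. Only words shorter than `l` enter the hypothesis, which
is what an induction on length can supply. -/
theorem deletionSum_eq {M : Type*} [AddCommGroup M] [Module ℂ M] (l : List (Fin (n - 1)))
    (j : Fin n) {φ : List (Fin (n - 1)) → M} {Φ : Equiv.Perm (Fin n) → M}
    (h : ∀ m, m.length < l.length → φ m = Φ (m.map simpleRefl).prod) :
    deletionSum l j φ = ∑ k, inversionCoeff (l.map simpleRefl).prod j k •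
      Φ (Equiv.swap j k * (l.map simpleRefl).prod) := by
  induction l generalizing j φ Φ with
  | nil => simp [deletionSum, inversionCoeff]
  | cons i l ih =>
    rw [deletionSum, ih (φ := fun m ↦ φ (i :: m)) (Φ := fun u ↦ Φ (simpleRefl i * u)),
      h l (by simp), List.map_cons, List.prod_cons]
    · set w := (l.map simpleRefl).prod
      have hs : (simpleRefl i)⁻¹ = simpleRefl i := Equiv.swap_inv _ _
      have h1 := sum_order_change i j fun u ↦ Φ (u * w)
      rw [one_mul] at h1
      rw [← h1, ← Equiv.sum_comp (simpleRefl i), ← Finset.sum_add_distrib]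
      refine Finset.sum_congr rfl fun k _ ↦ ?_
      have h2 : simpleRefl i * (Equiv.swap (simpleRefl i j) (simpleRefl i k) * w) =
          Equiv.swap j k * (simpleRefl i * w) := by
        have h3 (m : Fin n) : simpleRefl i (simpleRefl i m) = m := by simp [simpleRefl]
        rw [← mul_assoc, Equiv.mul_swap_eq_swap_mul, h3, h3, mul_assoc]
      rw [h2, mul_assoc, ← add_smul]
      congr 1
      simp only [inversionCoeff, mul_inv_rev, hs, Equiv.Perm.mul_apply]
      ring
    · intro m hm
      rw [h _ (by simpa using hm), List.map_cons, List.prod_cons]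

theorem wordOp_zero_apply (γ : ℝ) (l : List (Fin (n - 1))) (f : (Fin n → ℝ) → ℂ) :
    wordOp γ l f 0 = f 0 := by
  induction l with
  | nil => rfl
  | cons i l ih =>
    change deformedRefl γ i (wordOp γ l f) 0 = f 0
    rw [← ih, deformedRefl, intOp, permAct]
    simp

theorem contDiff_planeWave (lam : Fin n → ℂ) : ContDiff ℝ ∞ (planeWave lam) := by
  unfold planeWave
  refine Complex.contDiff_exp.comp (contDiff_const.mul (ContDiff.sum fun j _ ↦ ?_))
  exact contDiff_const.mul (Complex.ofRealCLM.contDiff.comp (contDiff_apply ℝ ℝ j))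

theorem partialDeriv_planeWave (lam : Fin n → ℂ) (j : Fin n) :
    partialDeriv j (planeWave lam) = (Complex.I * lam j) • planeWave lam := by
  ext x
  have h : HasFDerivAt (fun x : Fin n → ℝ ↦ Complex.I * ∑ j, lam j * x j)
      (Complex.I • ∑ j, lam j • (Complex.ofRealCLM.comp (.proj j))) x :=
    (HasFDerivAt.fun_sum fun j _ ↦ ((Complex.ofRealCLM.comp
      (.proj j : (Fin n → ℝ) →L[ℝ] ℝ)).hasFDerivAt.const_mul (lam j))).const_mul Complex.I
  unfold partialDeriv planeWave
  rw [h.cexp.fderiv]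
  simp [Pi.single_apply, apply_ite]
  ring

/-- On each ray through the origin the equation is a linear ODE. Multiplying by an integrating
factor makes `f` constant there. -/
theorem eq_zero_of_partialDeriv_eq_smul {f : (Fin n → ℝ) → ℂ} (hf : Differentiable ℝ f)
    (c : Fin n → ℂ) (h : ∀ j, partialDeriv j f = c j • f) (h0 : f 0 = 0) : f = 0 := by
  ext x
  have hd (y : Fin n → ℝ) : fderiv ℝ f y x = (∑ j, x j * c j) * f y := by
    rw [← ContinuousLinearMap.coe_coe, LinearMap.pi_apply_eq_sum_univ, Finset.sum_mul]
    refine Finset.sum_congr rfl fun j _ ↦ ?_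
    have h1 : (fun k ↦ if j = k then 1 else 0 : Fin n → ℝ) = Pi.single j 1 := by
      ext k; simp [Pi.single_apply, eq_comm]
    have h2 := congrFun (h j) y
    rw [partialDeriv] at h2
    rw [h1, ContinuousLinearMap.coe_coe, h2, Pi.smul_apply, Complex.real_smul, smul_eq_mul,
      mul_assoc]
  have h1 (t : ℝ) : HasDerivAt
      (fun t : ℝ ↦ Complex.exp (-(t * ∑ j, x j * c j)) * f (t • x)) 0 t := by
    have h2 : HasDerivAt (fun t : ℝ ↦ t • x) x t := by
      simpa using (hasDerivAt_id t).smul_const x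
    have h3 := (hf _).hasFDerivAt.comp_hasDerivAt t h2
    have h4 := (((Complex.ofRealCLM.hasDerivAt (x := t)).mul_const
      (∑ j, x j * c j : ℂ)).neg.cexp).mul h3
    convert! h4 using 1
    rw [hd]
    simp
    ring
  have h2 := is_const_of_deriv_eq_zero (fun t ↦ (h1 t).differentiableAt)
    (fun t ↦ (h1 t).deriv) 1 0
  simpa [h0] using h2

theorem wordOp_planeWave_eq (γ : ℝ) (lam : Fin n → ℂ) (L : ℕ) (l l' : List (Fin (n - 1)))
    (hl : l.length ≤ L) (hl' : l'.length ≤ L)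
    (h : (l.map simpleRefl).prod = (l'.map simpleRefl).prod) :
    wordOp γ l (planeWave lam) = wordOp γ l' (planeWave lam) := by
  induction L using Nat.strong_induction_on generalizing l l' with
  | _ L ih =>
    have hsm := contDiff_planeWave lam
    classical
    -- By the induction hypothesis, words shorter than `L` define an operator depending on the
    -- permutation alone. The default `0` is harmless: the same `Φ` occurs for both words and
    -- cancels.
    let Φ (u : Equiv.Perm (Fin n)) : (Fin n → ℝ) → ℂ :=
      if hu : ∃ m : List (Fin (n - 1)), m.length < L ∧ (m.map simpleRefl).prod = u then
        wordOp γ hu.choose (planeWave lam) else 0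
    have hΦ (m : List (Fin (n - 1))) (hm : m.length < L) :
        wordOp γ m (planeWave lam) = Φ (m.map simpleRefl).prod := by
      have hu : ∃ m' : List (Fin (n - 1)), m'.length < L ∧
        (m'.map simpleRefl).prod = (m.map simpleRefl).prod := ⟨m, hm, rfl⟩
      simp only [Φ, dif_pos hu]
      exact ih (max m.length hu.choose.length) (max_lt hm hu.choose_spec.1) _ _
        (le_max_left _ _) (le_max_right _ _) hu.choose_spec.2.symm
    have key (l : List (Fin (n - 1))) (hl : l.length ≤ L) (j : Fin n) :
        partialDeriv j (wordOp γ l (planeWave lam)) =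
          (Complex.I * lam ((l.map simpleRefl).prod⁻¹ j)) • wordOp γ l (planeWave lam) +
          (γ : ℂ) • ∑ k, inversionCoeff (l.map simpleRefl).prod j k •
            Φ (Equiv.swap j k * (l.map simpleRefl).prod) := by
      rw [partialDeriv_wordOp γ l j hsm, partialDeriv_planeWave, wordOp_smul,
        deletionSum_eq l j fun m hm ↦ hΦ m (hm.trans_le hl)]
    have h1 := contDiff_wordOp γ l hsm
    have h2 := contDiff_wordOp γ l' hsm
    rw [← sub_eq_zero]
    refine eq_zero_of_partialDeriv_eq_smul ((h1.sub h2).differentiable (by simp))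
      (fun j ↦ Complex.I * lam ((l.map simpleRefl).prod⁻¹ j)) (fun j ↦ ?_) ?_
    · have h3 : wordOp γ l (planeWave lam) - wordOp γ l' (planeWave lam) =
          wordOp γ l (planeWave lam) + (-1 : ℂ) • wordOp γ l' (planeWave lam) := by
        rw [neg_one_smul, sub_eq_add_neg]
      have h5 : ContDiff ℝ ∞ ((-1 : ℂ) • wordOp γ l' (planeWave lam)) := h2.const_smul (-1 : ℂ)
      rw [h3, partialDeriv_add j h1 h5]
      have h4 : partialDeriv j ((-1 : ℂ) • wordOp γ l' (planeWave lam)) =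
          (-1 : ℂ) • partialDeriv j (wordOp γ l' (planeWave lam)) := by
        ext x
        simp only [partialDeriv]
        rw [fderiv_const_smul ((h2.differentiable (by simp)) x)]
        rfl
      rw [h4, key l hl, key l' hl', ← h]
      module
    · simp [wordOp_zero_apply]

end Words

/-! ### Density of trigonometric polynomials, and `w_γ` on continuous functions -/

section Density

open BoundedContinuousFunction Uniformity

variable {n : ℕ}

/-- Stone–Weierstrass on `K`, applied to the star algebra spanned by characters with real
frequencies. -/
theorem exists_charPoly_near (f : C(Fin n → ℝ, ℂ)) {K : Set (Fin n → ℝ)} (hK : IsCompact K)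
    {ε : ℝ} (hε : 0 < ε) :
    ∃ c : AddMonoidAlgebra ℂ (Fin n → ℝ), ∀ x ∈ K,
      ‖c.coeff.sum (fun a z ↦ z * planeWave (fun j ↦ (a j : ℂ)) x) - f x‖ < ε := by
  have : CompactSpace K := isCompact_iff_compactSpace.mp hK
  let L : (Fin n → ℝ) →ₗ[ℝ] (Fin n → ℝ) →ₗ[ℝ] ℝ := dotProductBilin ℝ ℝ
  have hL : Continuous fun p : (Fin n → ℝ) × (Fin n → ℝ) ↦ L p.1 p.2 := by
    simp only [L, dotProductBilin_apply_apply, dotProduct]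
    fun_prop
  have hL' : ∀ v ≠ 0, L v ≠ 0 := by
    intro v hv h
    refine hv (funext fun j ↦ ?_)
    simpa [L] using LinearMap.congr_fun h (Pi.single j 1)
  let restr : C(Fin n → ℝ, ℂ) →⋆ₐ[ℂ] C(K, ℂ) :=
    ContinuousMap.compStarAlgHom' ℂ ℂ ⟨Subtype.val, continuous_subtype_val⟩
  let A : StarSubalgebra ℂ C(K, ℂ) :=
    ((charPoly Real.continuous_probChar hL).map (toContinuousMapStarₐ ℂ)).map restr
  have hA : A.SeparatesPoints := by
    intro x y hxy
    obtain ⟨_, ⟨g, hg, rfl⟩, hg'⟩ := separatesPoints_charPoly Real.continuous_probChar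
      Real.probChar_ne_one hL hL' (Subtype.coe_ne_coe.mpr hxy)
    exact ⟨_, ⟨restr g, ⟨g, hg, rfl⟩, rfl⟩, hg'⟩
  have h1 : restr f ∈ closure (A : Set C(K, ℂ)) := by
    rw [← StarSubalgebra.topologicalClosure_coe,
      ContinuousMap.starSubalgebra_topologicalClosure_eq_top_of_separatesPoints A hA]
    trivial
  obtain ⟨g, hgA, hg⟩ := Metric.mem_closure_iff.1 h1 ε hε
  obtain ⟨_, ⟨g, hg', rfl⟩, rfl⟩ := hgA
  obtain ⟨c, hc⟩ := (mem_charPoly g).1 hg'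
  refine ⟨c, fun x hx ↦ ?_⟩
  have h2 := (ContinuousMap.dist_lt_iff hε).1 hg ⟨x, hx⟩
  rw [dist_comm, dist_eq_norm] at h2
  have h3 : g x = c.coeff.sum (fun a z ↦ z * planeWave (fun j ↦ (a j : ℂ)) x) := by
    rw [hc]
    refine Finsupp.sum_congr fun a _ ↦ ?_
    rw [Real.probChar_apply, planeWave]
    simp [L, dotProduct, mul_comm]
  rw [← h3]
  exact h2

/-- Linear operators on continuous functions of several real variables that preserve joint
continuity in additional parameters. -/
structure ContLinOp {m : ℕ} (T : ((Fin n → ℝ) → ℂ) → (Fin m → ℝ) → ℂ) : Prop where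
  continuous_param : ∀ {S : Type} [TopologicalSpace S] {F : S → (Fin n → ℝ) → ℂ},
    Continuous (fun p : S × (Fin n → ℝ) ↦ F p.1 p.2) →
      Continuous fun p : S × (Fin m → ℝ) ↦ T (F p.1) p.2
  map_add : ∀ f g, Continuous f → Continuous g → T (f + g) = T f + T g
  map_smul : ∀ (c : ℂ) f, Continuous f → T (c • f) = c • T f

namespace ContLinOp

variable {m k : ℕ} {T T' : ((Fin n → ℝ) → ℂ) → (Fin m → ℝ) → ℂ}

theorem continuous (hT : ContLinOp T) {f : (Fin n → ℝ) → ℂ} (hf : Continuous f) :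
    Continuous (T f) :=
  (hT.continuous_param (S := Unit) (F := fun _ ↦ f) (hf.comp continuous_snd)).comp
    (Continuous.prodMk_right ())

theorem comp {U : ((Fin m → ℝ) → ℂ) → (Fin k → ℝ) → ℂ} (hU : ContLinOp U) (hT : ContLinOp T) :
    ContLinOp fun f ↦ U (T f) where
  continuous_param {_ _ F} hF :=
    hU.continuous_param (F := fun s ↦ T (F s)) (hT.continuous_param hF)
  map_add f g hf hg := by
    rw [hT.map_add f g hf hg, hU.map_add _ _ (hT.continuous hf) (hT.continuous hg)]
  map_smul c f hf := by rw [hT.map_smul c f hf, hU.map_smul _ _ (hT.continuous hf)]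

/-- The linear map between spaces of continuous functions given by an operator. -/
noncomputable def toLinearMap (hT : ContLinOp T) : C(Fin n → ℝ, ℂ) →ₗ[ℂ] C(Fin m → ℝ, ℂ) where
  toFun f := ⟨T f, hT.continuous f.continuous⟩
  map_add' f g := by
    ext x
    exact congrFun (hT.map_add f g f.continuous g.continuous) x
  map_smul' c f := by
    ext x
    exact congrFun (hT.map_smul c f f.continuous) x

/-- Taking the function itself as the parameter turns joint continuity into continuity for the
compact-open topology. -/
theorem continuous_apply (hT : ContLinOp T) (x : Fin m → ℝ) :
    Continuous fun f : C(Fin n → ℝ, ℂ) ↦ T f x :=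
  (hT.continuous_param (S := C(Fin n → ℝ, ℂ)) (F := fun f ↦ f) (by fun_prop)).comp
    (Continuous.prodMk_left x)

/-- Operators that agree on plane waves agree on continuous functions. -/
theorem eq_of_planeWave (hT : ContLinOp T) (hT' : ContLinOp T')
    (h : ∀ lam : Fin n → ℝ, T (planeWave fun j ↦ (lam j : ℂ)) = T' (planeWave fun j ↦ (lam j : ℂ)))
    {f : (Fin n → ℝ) → ℂ} (hf : Continuous f) : T f = T' f := by
  ext x
  let M : Set C(Fin n → ℝ, ℂ) := {f | T f x = T' f x}
  have hM : IsClosed M := isClosed_eq (hT.continuous_apply x) (hT'.continuous_apply x)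
  suffices (⟨f, hf⟩ : C(Fin n → ℝ, ℂ)) ∈ closure M from hM.closure_subset this
  rw [mem_closure_iff_nhds_basis (nhds_basis_uniformity'
    ContinuousMap.hasBasis_compactConvergenceUniformity)]
  rintro ⟨K, V⟩ ⟨hK, hV⟩
  obtain ⟨ε, hε, hεV⟩ := Metric.mem_uniformity_dist.1 hV
  obtain ⟨c, hc⟩ := exists_charPoly_near ⟨f, hf⟩ hK hε
  let e (a : Fin n → ℝ) : C(Fin n → ℝ, ℂ) := ⟨_, (contDiff_planeWave fun j ↦ (a j : ℂ)).continuous⟩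
  let g : C(Fin n → ℝ, ℂ) := c.coeff.sum fun a z ↦ z • e a
  have hg : hT.toLinearMap g = hT'.toLinearMap g := by
    simp only [g, Finsupp.sum, map_sum, LinearMap.map_smul]
    exact Finset.sum_congr rfl fun a _ ↦ congrArg _ (ContinuousMap.ext (congrFun (h a)))
  refine ⟨g, DFunLike.congr_fun hg x, fun y hy ↦ hεV ?_⟩
  rw [dist_comm, dist_eq_norm]
  have hgy : g y = c.coeff.sum fun a z ↦ z * planeWave (fun j ↦ (a j : ℂ)) y := by
    simp [g, Finsupp.sum, e]
  rw [hgy]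
  exact hc y hy

end ContLinOp

theorem contLinOp_wordOp (γ : ℝ) (l : List (Fin (n - 1))) : ContLinOp (wordOp (N := n) γ l) where
  continuous_param hF := continuous_wordOp γ l hF
  map_add _ _ hf hg := wordOp_add γ l hf hg
  map_smul c f _ := wordOp_smul γ l c f

theorem wordOp_eq_of_prod_eq (γ : ℝ) {l l' : List (Fin (n - 1))}
    (h : (l.map simpleRefl).prod = (l'.map simpleRefl).prod) {f : (Fin n → ℝ) → ℂ}
    (hf : Continuous f) : wordOp γ l f = wordOp γ l' f :=
  (contLinOp_wordOp γ l).eq_of_planeWave (contLinOp_wordOp γ l')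
    (fun _ ↦ wordOp_planeWave_eq γ _ _ l l' (le_max_left _ _) (le_max_right _ _) h) hf

theorem wordOp_eq_deformedPerm (γ : ℝ) (l : List (Fin (n - 1))) {f : (Fin n → ℝ) → ℂ}
    (hf : Continuous f) : wordOp γ l f = deformedPerm γ (l.map simpleRefl).prod f :=
  wordOp_eq_of_prod_eq γ (exists_word _).choose_spec.symm hf

theorem contLinOp_deformedPerm (γ : ℝ) (w : Equiv.Perm (Fin n)) :
    ContLinOp (deformedPerm (N := n) γ w) :=
  contLinOp_wordOp γ _

theorem contDiff_deformedPerm (γ : ℝ) (w : Equiv.Perm (Fin n)) {f : (Fin n → ℝ) → ℂ}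
    (hf : ContDiff ℝ ∞ f) : ContDiff ℝ ∞ (deformedPerm γ w f) :=
  contDiff_wordOp γ _ hf

theorem deformedPerm_mul (γ : ℝ) (w u : Equiv.Perm (Fin n)) {f : (Fin n → ℝ) → ℂ}
    (hf : Continuous f) : deformedPerm γ (w * u) f = deformedPerm γ w (deformedPerm γ u f) := by
  have h := wordOp_eq_deformedPerm γ ((exists_word w).choose ++ (exists_word u).choose) hf
  rw [List.map_append, List.prod_append, (exists_word w).choose_spec,
    (exists_word u).choose_spec] at h
  rw [← h, wordOp, List.foldr_append]
  rfl

theorem deformedPerm_simpleRefl (γ : ℝ) (i : Fin (n - 1)) {f : (Fin n → ℝ) → ℂ}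
    (hf : Continuous f) : deformedPerm γ (simpleRefl i) f = deformedRefl γ i f := by
  have h := (wordOp_eq_deformedPerm γ [i] hf).symm
  rw [List.map_singleton, List.prod_singleton] at h
  exact h

theorem deformedPerm_one (γ : ℝ) {f : (Fin n → ℝ) → ℂ} (hf : Continuous f) :
    deformedPerm γ 1 f = f :=
  (wordOp_eq_deformedPerm γ [] hf).symm

theorem partialDeriv_deformedPerm (γ : ℝ) (w : Equiv.Perm (Fin n)) (j : Fin n)
    {f : (Fin n → ℝ) → ℂ} (hf : ContDiff ℝ ∞ f) : partialDeriv j (deformedPerm γ w f) =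
      deformedPerm γ w (partialDeriv (w⁻¹ j) f) +
        (γ : ℂ) • ∑ k, inversionCoeff w j k • deformedPerm γ (Equiv.swap j k * w) f := by
  have h := partialDeriv_wordOp γ (exists_word w).choose j hf
  rwa [deletionSum_eq _ j (Φ := fun u ↦ deformedPerm γ u f)
    fun m _ ↦ wordOp_eq_deformedPerm γ m hf.continuous, (exists_word w).choose_spec] at h

end Density

/-! ### Gluing the propagation operator across the walls -/

section Propagation

open Filter Topology

variable {n : ℕ}

theorem deformedRefl_apply_of_eq (γ : ℝ) (i : Fin (n - 1)) (f : (Fin n → ℝ) → ℂ) {x : Fin n → ℝ}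
    (hx : x ⟨i, by omega⟩ = x ⟨i + 1, by omega⟩) : deformedRefl γ i f x = f x := by
  have h : x ∘ simpleRefl i = x := by rw [simpleRefl, comp_swap_eq_sub, hx]; simp
  rw [deformedRefl, permAct, h, intOp, hx]
  simp

theorem exists_descent {u : Equiv.Perm (Fin n)} (hu : u ≠ 1) :
    ∃ i : Fin (n - 1), u ⟨i + 1, by omega⟩ < u ⟨i, by omega⟩ := by
  cases n with
  | zero => exact (hu (Subsingleton.elim _ _)).elim
  | succ n =>
    by_contra! h
    refine hu (u.monotone_iff.1 (Fin.monotone_iff_le_succ.2 fun i ↦ ?_))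
    exact h i

/-- At a descent `i` of `u`, monotonicity and invariance of `x` force `x_i = x_{i+1}`, so the
integral in `s_{i,γ}` vanishes at `x`. The permutation `u s_i` still fixes `x` and is
lexicographically smaller. The function must vary in the induction, since `u s_i` is applied to
`s_{i,γ} f`. -/
theorem deformedPerm_apply_of_stabilizer (γ : ℝ) (u : Equiv.Perm (Fin n)) {f : (Fin n → ℝ) → ℂ}
    (hf : Continuous f) {x : Fin n → ℝ} (hx : Antitone x) (hu : x ∘ u = x) :
    deformedPerm γ u f x = f x := by
  induction h : toLex (u : Fin n → Fin n) using WellFoundedLT.induction generalizing u f with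
  | _ a ih =>
    subst h
    by_cases h1 : u = 1
    · rw [h1, deformedPerm_one γ hf]
    obtain ⟨i, hi⟩ := exists_descent h1
    have hlt : (⟨i, by omega⟩ : Fin n) < ⟨i + 1, by omega⟩ := Fin.mk_lt_mk.2 (Nat.lt_succ_self _)
    have hxi : x ⟨i, by omega⟩ = x ⟨i + 1, by omega⟩ := by
      refine le_antisymm ?_ (hx hlt.le)
      rw [← hu]
      exact hx hi.le
    have hs : x ∘ simpleRefl i = x := by rw [simpleRefl, comp_swap_eq_sub, hxi]; simp
    have hss : simpleRefl i * simpleRefl i = 1 := Equiv.swap_mul_self _ _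
    have h2 : u = u * simpleRefl i * simpleRefl i := by rw [mul_assoc, hss, mul_one]
    have h3 : Continuous (deformedPerm γ (simpleRefl i) f) :=
      (contLinOp_deformedPerm γ _).continuous hf
    rw [h2, deformedPerm_mul γ _ _ hf, ih _ _ (u * simpleRefl i) h3 _ rfl,
      deformedPerm_simpleRefl γ i hf, deformedRefl_apply_of_eq γ i f hxi]
    · exact Pi.lex_desc hlt.le hi
    · rw [Equiv.Perm.coe_mul, ← Function.comp_assoc, hu, hs]

/-- Two permutations sorting `x` give the same sorted vector, and `w w'⁻¹` fixes it. -/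
theorem deformedPerm_apply_eq (γ : ℝ) {w w' : Equiv.Perm (Fin n)} {f : (Fin n → ℝ) → ℂ}
    (hf : Continuous f) {x : Fin n → ℝ} (hw : Antitone (x ∘ ⇑w⁻¹)) (hw' : Antitone (x ∘ ⇑w'⁻¹)) :
    deformedPerm γ w f (x ∘ ⇑w⁻¹) = deformedPerm γ w' f (x ∘ ⇑w'⁻¹) := by
  have h1 : x ∘ ⇑w⁻¹ = x ∘ ⇑w'⁻¹ := Tuple.unique_antitone hw hw'
  have h2 : (x ∘ ⇑w⁻¹) ∘ ⇑(w * w'⁻¹) = x ∘ ⇑w⁻¹ := by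
    rw [h1]
    nth_rewrite 1 [← h1]
    ext i
    simp
  have h3 := deformedPerm_apply_of_stabilizer γ (w * w'⁻¹)
    ((contLinOp_deformedPerm γ w').continuous hf) hw h2
  rw [← deformedPerm_mul γ _ _ hf, inv_mul_cancel_right, h1] at h3
  rwa [h1]

/-- A permutation that sorts the coordinates of a vector. -/
noncomputable def sortPerm (x : Fin n → ℝ) : Equiv.Perm (Fin n) := (Tuple.sort (-x))⁻¹

theorem antitone_sortPerm (x : Fin n → ℝ) : Antitone (x ∘ ⇑(sortPerm x)⁻¹) := by
  intro i j hij
  simpa [sortPerm] using Tuple.monotone_sort (-x) hij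

/-- Add `ε i` to the `i`-th coordinate: each pair of coordinates excludes only one `ε`. -/
theorem dense_regular (n : ℕ) : Dense (regular n) := by
  intro x
  have h (i j : Fin n) (hij : i ≠ j) : ∀ᶠ ε : ℝ in 𝓝[≠] 0, x i + ε * i ≠ x j + ε * j := by
    have hij' : ((j : ℕ) : ℝ) - (i : ℕ) ≠ 0 := by
      exact sub_ne_zero.2 (Nat.cast_injective.ne (Fin.val_ne_iff.2 hij.symm))
    have h1 : ∀ᶠ ε : ℝ in 𝓝[≠] 0, ε ≠ (x i - x j) / (j - i) := by
      by_cases h0 : (x i - x j) / ((j : ℕ) - (i : ℕ) : ℝ) = 0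
      · rw [h0]; exact self_mem_nhdsWithin
      · exact eventually_nhdsWithin_of_eventually_nhds (isOpen_ne.mem_nhds (Ne.symm h0))
    filter_upwards [h1] with ε hε h2
    refine hε ((eq_div_iff hij').2 ?_)
    linarith
  have h2 : ∀ᶠ ε : ℝ in 𝓝[≠] 0, (fun i ↦ x i + ε * (i : ℕ)) ∈ regular n := by
    have : ∀ᶠ ε : ℝ in 𝓝[≠] 0, ∀ i j : Fin n, i ≠ j → x i + ε * i ≠ x j + ε * j := by
      simpa only [eventually_all] using h
    filter_upwards [this] with ε hε i j hij
    by_contra hne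
    exact hε i j hne hij
  refine mem_closure_of_tendsto (b := 𝓝[≠] (0 : ℝ)) (f := fun ε i ↦ x i + ε * (i : ℕ)) ?_ h2
  have h3 : Continuous fun ε : ℝ ↦ (fun i ↦ x i + ε * (i : ℕ) : Fin n → ℝ) := by fun_prop
  have h4 := h3.tendsto 0
  simp only [zero_mul, add_zero] at h4
  exact h4.mono_left nhdsWithin_le_nhds

theorem propagationReg_apply (γ : ℝ) (f : (Fin n → ℝ) → ℂ) {x : Fin n → ℝ} (hx : x ∈ regular n)
    {w : Equiv.Perm (Fin n)} (hw : Antitone (x ∘ ⇑w⁻¹)) :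
    propagationReg γ f x = deformedPerm γ w f (x ∘ ⇑w⁻¹) := by
  rw [propagationReg, Finset.sum_eq_single w]
  · refine Set.indicator_of_mem (s := alcove n) (a := x ∘ ⇑w⁻¹) ?_ _
    exact hw.strictAnti_of_injective (Function.Injective.comp hx (w⁻¹).injective)
  · intro u _ hu
    refine Set.indicator_of_notMem (s := alcove n) (a := x ∘ ⇑u⁻¹) (fun h ↦ hu ?_) _
    have h1 : x ∘ ⇑u⁻¹ = x ∘ ⇑w⁻¹ := Tuple.unique_antitone (StrictAnti.antitone h) hw
    refine inv_injective (Equiv.ext fun i ↦ hx (congrFun h1 i))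
  · simp

/-- The values of the propagation operator, computed by sorting the coordinates. -/
noncomputable def sortedPropagation (γ : ℝ) (f : (Fin n → ℝ) → ℂ) (x : Fin n → ℝ) : ℂ :=
  deformedPerm γ (sortPerm x) f (x ∘ ⇑(sortPerm x)⁻¹)

theorem continuous_comp_perm (w : Equiv.Perm (Fin n)) :
    Continuous fun x : Fin n → ℝ ↦ x ∘ ⇑w :=
  continuous_pi fun _ ↦ continuous_apply _

/-- The closed chambers form a finite cover; on each of them the function is given by a single
deformed permutation. -/
theorem continuous_sortedPropagation (γ : ℝ) {S : Type} [TopologicalSpace S]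
    {F : S → (Fin n → ℝ) → ℂ} (hF : Continuous fun p : S × (Fin n → ℝ) ↦ F p.1 p.2) :
    Continuous fun p : S × (Fin n → ℝ) ↦ sortedPropagation γ (F p.1) p.2 := by
  refine (locallyFinite_of_finite fun w : Equiv.Perm (Fin n) ↦
    {p : S × (Fin n → ℝ) | Antitone (p.2 ∘ ⇑w⁻¹)}).continuous ?_ (fun w ↦ ?_) fun w ↦ ?_
  · exact Set.eq_univ_of_forall fun p ↦ Set.mem_iUnion.2 ⟨sortPerm p.2, antitone_sortPerm p.2⟩
  · simp only [Antitone, Set.ofPred_forall, Function.comp_apply]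
    refine isClosed_iInter fun i ↦ isClosed_iInter fun j ↦ isClosed_iInter fun _ ↦ ?_
    exact isClosed_le (by fun_prop) (by fun_prop)
  · have h : Continuous fun p : S × (Fin n → ℝ) ↦ deformedPerm γ w (F p.1) (p.2 ∘ ⇑w⁻¹) :=
      ((contLinOp_deformedPerm γ w).continuous_param hF).comp
        (continuous_fst.prodMk ((continuous_comp_perm w⁻¹).comp continuous_snd))
    refine h.continuousOn.congr fun p hp ↦ ?_
    exact deformedPerm_apply_eq γ (hF.comp (Continuous.prodMk_right p.1))
      (antitone_sortPerm p.2) hp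

theorem propagation_eq_sortedPropagation (γ : ℝ) {f : (Fin n → ℝ) → ℂ} (hf : Continuous f) :
    propagation γ f = sortedPropagation γ f := by
  ext x
  have h0 := continuous_sortedPropagation γ (S := Unit) (F := fun _ ↦ f) (hf.comp continuous_snd)
  have h : Continuous (sortedPropagation γ f) :=
    h0.comp (f := fun x : Fin n → ℝ ↦ ((), x)) (by fun_prop)
  refine extendFrom_eq (dense_regular n x) ?_
  refine (h.continuousWithinAt (s := regular n) (x := x)).tendsto.congr' ?_
  filter_upwards [self_mem_nhdsWithin] with y hy
  exact (propagationReg_apply γ f hy (antitone_sortPerm y)).symm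

theorem propagation_apply (γ : ℝ) {f : (Fin n → ℝ) → ℂ} (hf : Continuous f) {x : Fin n → ℝ}
    {w : Equiv.Perm (Fin n)} (hw : Antitone (x ∘ ⇑w⁻¹)) :
    propagation γ f x = deformedPerm γ w f (x ∘ ⇑w⁻¹) := by
  rw [propagation_eq_sortedPropagation γ hf]
  exact deformedPerm_apply_eq γ hf (antitone_sortPerm x) hw

theorem contLinOp_propagation (γ : ℝ) : ContLinOp (propagation (N := n) γ) where
  continuous_param {S _ F} hF := by
    have h (s : S) := propagation_eq_sortedPropagation γ (hF.comp (Continuous.prodMk_right s))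
    have h' (s : S) : propagation γ (F s) = sortedPropagation γ (F s) := h s
    simp_rw [h']
    exact continuous_sortedPropagation γ hF
  map_add f g hf hg := by
    ext x
    have hx := antitone_sortPerm x
    rw [Pi.add_apply, propagation_apply γ (hf.add hg) hx, propagation_apply γ hf hx,
      propagation_apply γ hg hx]
    exact congrFun ((contLinOp_deformedPerm γ _).map_add f g hf hg) _
  map_smul c f hf := by
    ext x
    have hx := antitone_sortPerm x
    have hcf : Continuous (c • f) := hf.const_smul c
    rw [Pi.smul_apply, propagation_apply γ hcf hx, propagation_apply γ hf hx]
    exact congrFun ((contLinOp_deformedPerm γ _).map_smul c f hf) _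

theorem propagation_mem_CBSmooth (γ : ℝ) {f : (Fin n → ℝ) → ℂ} (hf : ContDiff ℝ ∞ f) :
    propagation γ f ∈ CBSmooth n := by
  refine ⟨(contLinOp_propagation γ).continuous hf.continuous, fun x hx ↦ ?_⟩
  refine ContDiffAt.contDiffWithinAt ?_
  set w := sortPerm x
  have h1 : ContDiff ℝ ∞ fun y : Fin n → ℝ ↦ deformedPerm γ w f (y ∘ ⇑w⁻¹) :=
    (contDiff_deformedPerm γ w hf).comp (contDiff_pi.2 fun i ↦ contDiff_apply ℝ ℝ _)
  refine h1.contDiffAt.congr_of_eventuallyEq ?_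
  -- Near a regular point the coordinates keep their order, so one permutation sorts all nearby
  -- points.
  have h2 : ∀ᶠ y : Fin n → ℝ in 𝓝 x, ∀ i j : Fin n, i < j → y (w⁻¹ j) < y (w⁻¹ i) := by
    simp only [eventually_all]
    intro i j hij
    refine (isOpen_lt (f := fun y : Fin n → ℝ ↦ y (w⁻¹ j)) (g := fun y ↦ y (w⁻¹ i))
      (continuous_apply _) (continuous_apply _)).mem_nhds ?_
    exact (antitone_sortPerm x).strictAnti_of_injective
      (Function.Injective.comp hx (w⁻¹).injective) hij
  filter_upwards [h2] with y hy
  have h3 : StrictAnti (y ∘ ⇑w⁻¹) := fun i j hij ↦ hy i j hij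
  exact propagation_apply γ hf.continuous h3.antitone

end Propagation

/-! ### The creation operators and the integral equation for `b⁻_μ` -/

section Creation

variable {N : ℕ}

theorem continuous_intervalIntegral_of_continuous {X : Type*} [TopologicalSpace X]
    {f : X → ℝ → ℂ} (hf : Continuous (Function.uncurry f)) {a b : X → ℝ} (ha : Continuous a)
    (hb : Continuous b) : Continuous fun x ↦ ∫ t in a x..b x, f x t := by
  have h (x : X) : ∫ t in a x..b x, f x t = (∫ t in (0 : ℝ)..b x, f x t) - ∫ t in (0 : ℝ)..a x, f x t :=
    (intervalIntegral.integral_interval_sub_left ((hf.uncurry_left x).intervalIntegrable _ _)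
      ((hf.uncurry_left x).intervalIntegrable _ _)).symm
  simp_rw [h]
  exact (intervalIntegral.continuous_parametric_intervalIntegral_of_continuous hf hb).sub
    (intervalIntegral.continuous_parametric_intervalIntegral_of_continuous hf ha)

/-- The elementary integral operators, written so that continuity is apparent: the last coordinate
is separated from the others, and the upper limits of the integrals are cut off. -/
noncomputable def chainIntegral (μ : ℂ) (h : (Fin N → ℝ) → ℂ) :
    List (Fin N) → (Fin N → ℝ) → ℝ → ℂ
  | [], x, t => Complex.exp (Complex.I * μ * t) * h x
  | i :: l, x, t => ∫ y in (x i)..(max t (x i)),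
      Complex.exp (Complex.I * μ * ((t : ℂ) - y)) *
        chainIntegral μ h l (Function.update x i y) (x i)

theorem continuous_chainIntegral (μ : ℂ) {S : Type*} [TopologicalSpace S]
    {F : S → (Fin N → ℝ) → ℂ} (hF : Continuous fun p : S × (Fin N → ℝ) ↦ F p.1 p.2)
    (l : List (Fin N)) :
    Continuous fun p : S × (Fin N → ℝ) × ℝ ↦ chainIntegral μ (F p.1) l p.2.1 p.2.2 := by
  induction l with
  | nil =>
    exact .mul (by fun_prop) (hF.comp (f := fun p : S × (Fin N → ℝ) × ℝ ↦ (p.1, p.2.1))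
      (by fun_prop))
  | cons i l ih =>
    refine continuous_intervalIntegral_of_continuous ?_ (by fun_prop) (by fun_prop)
    refine .mul (by fun_prop) ?_
    exact ih.comp (f := fun q : (S × (Fin N → ℝ) × ℝ) × ℝ ↦
      (q.1.1, Function.update q.1.2.1 i q.2, q.1.2.1 i)) (by fun_prop)

theorem Continuous.chainIntegral_update (μ : ℂ) {h : (Fin N → ℝ) → ℂ} (hh : Continuous h)
    (l : List (Fin N)) (x : Fin N → ℝ) (t : ℝ) (i : Fin N) :
    Continuous fun y : ℝ ↦ Complex.exp (Complex.I * μ * ((t : ℂ) - y)) *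
      chainIntegral μ h l (Function.update x i y) (x i) := by
  refine .mul (by fun_prop) ?_
  exact (continuous_chainIntegral μ (S := Unit) (F := fun _ ↦ h) (hh.comp continuous_snd) l).comp
    (f := fun y : ℝ ↦ ((), Function.update x i y, x i)) (by fun_prop)

theorem chainIntegral_add (μ : ℂ) {f g : (Fin N → ℝ) → ℂ} (hf : Continuous f) (hg : Continuous g)
    (l : List (Fin N)) (x : Fin N → ℝ) (t : ℝ) :
    chainIntegral μ (f + g) l x t = chainIntegral μ f l x t + chainIntegral μ g l x t := by
  induction l generalizing x t with
  | nil => simp [chainIntegral, mul_add]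
  | cons i l ih =>
    simp only [chainIntegral, ih, mul_add]
    exact intervalIntegral.integral_add
      ((Continuous.chainIntegral_update μ hf l x t i).intervalIntegrable _ _)
      ((Continuous.chainIntegral_update μ hg l x t i).intervalIntegrable _ _)

theorem chainIntegral_smul (μ c : ℂ) (f : (Fin N → ℝ) → ℂ) (l : List (Fin N)) (x : Fin N → ℝ)
    (t : ℝ) : chainIntegral μ (c • f) l x t = c * chainIntegral μ f l x t := by
  induction l generalizing x t with
  | nil => simp [chainIntegral, mul_left_comm]
  | cons i l ih =>
    simp only [chainIntegral, ih, ← intervalIntegral.integral_const_mul, mul_left_comm c]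

theorem iterInt_congr (μ : ℂ) {x x' : Fin N → ℝ} (h : (Fin N → ℝ) → ℂ) {l : List (Fin N)}
    (hx : ∀ i ∈ l, x i = x' i) (a : ℝ) (z : Fin N → ℝ) :
    iterInt μ x h l a z = iterInt μ x' h l a z := by
  induction l generalizing a z with
  | nil => rfl
  | cons i l ih =>
    have hi := hx i (by simp)
    simp only [iterInt, hi, ih fun j hj ↦ hx j (by simp [hj])]

-- The cut-off `max t (x i)` encodes the step function: an integral vanishes unless its lower limit
-- lies below `t`. The prefactor `e^{iμt}` is carried inside the chain and shifted from one variable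
-- to the next.
open Classical in
theorem chainIntegral_ofFn (μ : ℂ) (h : (Fin N → ℝ) → ℂ) {n : ℕ} (i : Fin n → Fin N)
    (x : Fin N → ℝ) (t : ℝ) : chainIntegral μ h (List.ofFn i) x t =
      if StrictAnti (Fin.cons t (fun m ↦ x (i m)) : Fin (n + 1) → ℝ) then
        Complex.exp (Complex.I * μ * t) * iterInt μ x h (List.ofFn i) t x else 0 := by
  induction n generalizing x t with
  | zero =>
    rw [if_pos (Fin.strictAnti_iff_succ_lt.2 fun i ↦ i.elim0)]
    simp [chainIntegral, iterInt]
  | succ n ih =>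
    have hcons : StrictAnti (Fin.cons t (fun m ↦ x (i m)) : Fin (n + 1 + 1) → ℝ) ↔
        x (i 0) < t ∧ StrictAnti fun m ↦ x (i m) := strictAnti_vecCons
    have hself : (Fin.cons (x (i 0)) (fun m : Fin n ↦ x (i m.succ)) : Fin (n + 1) → ℝ) =
        fun m ↦ x (i m) := Fin.cons_self_tail fun m ↦ x (i m)
    simp only [List.ofFn_succ, chainIntegral, ih, iterInt, hcons]
    -- If the leading index recurs, its coordinate has become some `y ≥ x (i 0)`, while the inner
    -- chain requires it to be below `x (i 0)`. So the integrand is zero.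
    by_cases hm : ∃ m : Fin n, i m.succ = i 0
    · obtain ⟨m, hm⟩ := hm
      rw [if_neg]
      · refine (intervalIntegral.integral_congr (g := fun _ ↦ 0) fun y hy ↦ ?_).trans (by simp)
        rw [Set.uIcc_of_le (le_max_right _ _)] at hy
        simp only
        rw [if_neg, mul_zero]
        intro hanti
        have h1 := hanti (Fin.succ_pos m)
        simp only [Fin.cons_succ, Fin.cons_zero, hm, Function.update_self] at h1
        exact absurd hy.1 (not_le.2 h1)
      · rintro ⟨-, hanti⟩
        have h1 := hanti (Fin.succ_pos m)
        simp [hm] at h1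
    · push Not at hm
      have hup (y : ℝ) : (fun m : Fin n ↦ Function.update x (i 0) y (i m.succ)) =
          fun m ↦ x (i m.succ) := funext fun m ↦ Function.update_of_ne (hm m) _ _
      simp only [hup, hself]
      by_cases hanti : StrictAnti fun m ↦ x (i m)
      · rcases lt_or_ge (x (i 0)) t with ht | ht
        · rw [if_pos ⟨ht, hanti⟩, max_eq_left ht.le, ← intervalIntegral.integral_const_mul]
          refine intervalIntegral.integral_congr fun y _ ↦ ?_
          simp only [if_pos hanti]
          rw [iterInt_congr μ (x' := x) h, ← mul_assoc, ← mul_assoc, ← Complex.exp_add,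
            ← Complex.exp_add]
          · congr 2
            ring
          · intro j hj
            obtain ⟨m, rfl⟩ := (List.mem_ofFn' _ _).1 hj
            exact Function.update_of_ne (hm m) _ _
        · rw [if_neg fun h ↦ not_lt.2 ht h.1, max_eq_right ht, intervalIntegral.integral_same]
      · simp [hanti]

/-- The non-symmetric creation operator, with the last coordinate separated from the others. -/
noncomputable def creationAt (γ : ℝ) (μ : ℂ) (h : (Fin N → ℝ) → ℂ) (x : Fin N → ℝ) (t : ℝ) : ℂ :=
  ∑ n ∈ Finset.range (N + 1),
    (γ : ℂ) ^ n * ∑ i : Fin n → Fin N, chainIntegral μ h (List.ofFn i) x t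

theorem chainIntegral_ofFn_of_not_injective (μ : ℂ) (h : (Fin N → ℝ) → ℂ) {n : ℕ}
    {i : Fin n → Fin N} (hi : ¬ Function.Injective i) (x : Fin N → ℝ) (t : ℝ) :
    chainIntegral μ h (List.ofFn i) x t = 0 := by
  rw [chainIntegral_ofFn, if_neg fun hanti ↦ hi fun a b hab ↦ ?_]
  have h1 := hanti.injective (a₁ := a.succ) (a₂ := b.succ) (by simp [hab])
  exact Fin.succ_injective _ h1

theorem creation_apply (γ : ℝ) (μ : ℂ) (h : (Fin N → ℝ) → ℂ) (x : Fin (N + 1) → ℝ) :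
    creation γ μ h x = creationAt γ μ h (Fin.init x) (x (Fin.last N)) := by
  classical
  refine Finset.sum_congr rfl fun n _ ↦ congrArg _ ?_
  rw [← Finset.sum_filter_of_ne (p := Function.Injective) fun i _ hne ↦ by
    by_contra hi
    exact hne (chainIntegral_ofFn_of_not_injective μ h hi _ _)]
  refine Finset.sum_bij (fun i _ ↦ ⇑i) (fun i _ ↦ ?_) (fun i _ j _ hij ↦ ?_) (fun i hi ↦ ?_)
    fun i _ ↦ ?_
  · simpa using i.injective
  · exact DFunLike.coe_injective hij
  · exact ⟨⟨i, (Finset.mem_filter.1 hi).2⟩, Finset.mem_univ _, rfl⟩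
  · rw [chainIntegral_ofFn, elemCreation]

theorem creationAt_recursion (γ : ℝ) (μ : ℂ) {h : (Fin N → ℝ) → ℂ} (hh : Continuous h)
    (x : Fin N → ℝ) (t : ℝ) : creationAt γ μ h x t =
      Complex.exp (Complex.I * μ * t) * h x + γ * ∑ i, ∫ y in (x i)..(max t (x i)),
        Complex.exp (Complex.I * μ * ((t : ℂ) - y)) *
          creationAt γ μ h (Function.update x i y) (x i) := by
  -- The term `n = N + 1` is zero, as no tuple of that length is injective. Adding it leaves the
  -- full range of `n` for the inner operator once the first index is split off.
  have h1 : creationAt γ μ h x t = ∑ n ∈ Finset.range (N + 1 + 1),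
      (γ : ℂ) ^ n * ∑ i : Fin n → Fin N, chainIntegral μ h (List.ofFn i) x t := by
    rw [Finset.sum_range_succ, creationAt, left_eq_add, Finset.sum_eq_zero, mul_zero]
    intro i _
    refine chainIntegral_ofFn_of_not_injective μ h (fun hi ↦ ?_) x t
    simpa using Fintype.card_le_of_injective i hi
  have h2 (i : Fin N) : ∫ y in (x i)..(max t (x i)), Complex.exp (Complex.I * μ * ((t : ℂ) - y)) *
      creationAt γ μ h (Function.update x i y) (x i) = ∑ n ∈ Finset.range (N + 1),
        (γ : ℂ) ^ n * ∑ i' : Fin n → Fin N, chainIntegral μ h (i :: List.ofFn i') x t := by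
    simp only [creationAt, Finset.mul_sum, mul_left_comm (Complex.exp _)]
    have hc (n : ℕ) (i' : Fin n → Fin N) : Continuous fun y : ℝ ↦ (γ : ℂ) ^ n *
        (Complex.exp (Complex.I * μ * ((t : ℂ) - y)) *
          chainIntegral μ h (List.ofFn i') (Function.update x i y) (x i)) :=
      continuous_const.mul (Continuous.chainIntegral_update μ hh _ x t i)
    rw [intervalIntegral.integral_finsetSum fun n _ ↦
      (continuous_finsetSum _ fun i' _ ↦ hc n i').intervalIntegrable _ _]
    refine Finset.sum_congr rfl fun n _ ↦ ?_
    rw [intervalIntegral.integral_finsetSum fun i' _ ↦ (hc n i').intervalIntegrable _ _]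
    exact Finset.sum_congr rfl fun i' _ ↦ intervalIntegral.integral_const_mul _ _
  have h3 (n : ℕ) : ∑ i : Fin (n + 1) → Fin N, chainIntegral μ h (List.ofFn i) x t =
      ∑ i, ∑ i' : Fin n → Fin N, chainIntegral μ h (i :: List.ofFn i') x t := by
    rw [← Fintype.sum_prod_type', ← (Fin.consEquiv fun _ : Fin (n + 1) ↦ Fin N).sum_comp]
    refine Finset.sum_congr rfl fun p _ ↦ ?_
    simp [Fin.consEquiv, List.ofFn_succ]
  rw [h1, Finset.sum_range_succ', add_comm]
  congr 1
  · simp [chainIntegral]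
  · simp_rw [h2, h3]
    rw [Finset.sum_comm, Finset.mul_sum]
    refine Finset.sum_congr rfl fun n _ ↦ ?_
    rw [← Finset.mul_sum, pow_succ', mul_assoc]

/-- Induction on the number of coordinates below `t`. Inside the `i`-th integral the new threshold
is `x_i < t` and the replaced coordinate satisfies `y ≥ x_i`, so `i` is no longer counted and no
index is gained. -/
theorem eq_of_creation_recursion (γ : ℝ) (μ : ℂ) {h : (Fin N → ℝ) → ℂ}
    {F G : (Fin N → ℝ) → ℝ → ℂ}
    (hF : ∀ x t, F x t = Complex.exp (Complex.I * μ * t) * h x +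
      γ * ∑ i, ∫ y in (x i)..(max t (x i)),
        Complex.exp (Complex.I * μ * ((t : ℂ) - y)) * F (Function.update x i y) (x i))
    (hG : ∀ x t, G x t = Complex.exp (Complex.I * μ * t) * h x +
      γ * ∑ i, ∫ y in (x i)..(max t (x i)),
        Complex.exp (Complex.I * μ * ((t : ℂ) - y)) * G (Function.update x i y) (x i))
    (x : Fin N → ℝ) (t : ℝ) : F x t = G x t := by
  classical
  induction hk : (Finset.univ.filter fun i ↦ x i < t).card using Nat.strong_induction_on
    generalizing x t with
  | _ k ih =>
    rw [hF, hG]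
    congr 2
    refine Finset.sum_congr rfl fun i _ ↦ ?_
    rcases lt_or_ge (x i) t with hi | hi
    · refine intervalIntegral.integral_congr fun y hy ↦ ?_
      rw [Set.uIcc_of_le (le_max_right _ _)] at hy
      rw [ih _ ?_ _ _ rfl]
      rw [← hk]
      refine Finset.card_lt_card ((Finset.ssubset_iff_of_subset fun j hj ↦ ?_).2 ⟨i, ?_, ?_⟩)
      · rw [Finset.mem_filter] at hj ⊢
        refine ⟨hj.1, ?_⟩
        rcases eq_or_ne j i with rfl | hji
        · exact hi
        · rw [Function.update_of_ne hji] at hj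
          exact hj.2.trans hi
      · simpa using hi
      · simpa using hy.1
    · rw [max_eq_right hi, intervalIntegral.integral_same, intervalIntegral.integral_same]

theorem continuous_init : Continuous fun x : Fin (N + 1) → ℝ ↦ (Fin.init x : Fin N → ℝ) :=
  continuous_pi fun _ ↦ continuous_apply _

theorem contLinOp_creation (γ : ℝ) (μ : ℂ) : ContLinOp (creation (N := N) γ μ) where
  continuous_param {S _ F} hF := by
    simp_rw [creation_apply, creationAt]
    refine continuous_finsetSum _ fun n _ ↦ continuous_const.mul
      (continuous_finsetSum _ fun i _ ↦ ?_)
    exact (continuous_chainIntegral μ hF (List.ofFn i)).comp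
      (f := fun p : S × (Fin (N + 1) → ℝ) ↦ (p.1, (Fin.init p.2 : Fin N → ℝ), p.2 (Fin.last N)))
      (continuous_fst.prodMk ((continuous_init.comp continuous_snd).prodMk (by fun_prop)))
  map_add f g hf hg := by
    ext x
    simp only [Pi.add_apply, creation_apply, creationAt, chainIntegral_add μ hf hg,
      Finset.sum_add_distrib, mul_add]
  map_smul c f _ := by
    ext x
    simp only [Pi.smul_apply, creation_apply, creationAt, chainIntegral_smul, smul_eq_mul,
      ← Finset.mul_sum, mul_left_comm _ c]

theorem contLinOp_freeCreation (μ : ℂ) : ContLinOp (freeCreation (N := N) μ) where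
  continuous_param {S _ F} hF := by
    refine .mul (by fun_prop) (hF.comp (f := fun p : S × (Fin (N + 1) → ℝ) ↦
      (p.1, (Fin.init p.2 : Fin N → ℝ))) ?_)
    exact continuous_fst.prodMk (continuous_init.comp continuous_snd)
  map_add f g _ _ := by
    ext x
    exact mul_add _ _ _
  map_smul c f _ := by
    ext x
    exact mul_left_comm _ _ _

theorem contDiff_exp_last (μ : ℂ) :
    ContDiff ℝ ∞ fun x : Fin (N + 1) → ℝ ↦ Complex.exp (Complex.I * μ * x (Fin.last N)) :=
  Complex.contDiff_exp.comp
    (contDiff_const.mul (Complex.ofRealCLM.contDiff.comp (contDiff_apply ℝ ℝ _)))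

theorem contDiff_init : ContDiff ℝ ∞ fun x : Fin (N + 1) → ℝ ↦ (Fin.init x : Fin N → ℝ) :=
  contDiff_pi.2 fun _ ↦ contDiff_apply ℝ ℝ _

theorem contDiff_freeCreation (μ : ℂ) {f : (Fin N → ℝ) → ℂ} (hf : ContDiff ℝ ∞ f) :
    ContDiff ℝ ∞ (freeCreation μ f) :=
  (contDiff_exp_last μ).mul (hf.comp contDiff_init)

theorem freeCreation_mem_CBSmooth (μ : ℂ) {f : (Fin N → ℝ) → ℂ} (hf : f ∈ CBSmooth N) :
    freeCreation μ f ∈ CBSmooth (N + 1) := by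
  refine ⟨(contLinOp_freeCreation μ).continuous hf.1, (contDiff_exp_last μ).contDiffOn.mul
    (hf.2.comp contDiff_init.contDiffOn fun x hx ↦ ?_)⟩
  exact Function.Injective.comp hx (Fin.castSucc_injective N)

theorem freeCreation_planeWave (μ : ℂ) (lam : Fin N → ℂ) :
    freeCreation μ (planeWave lam) = planeWave (Fin.snoc lam μ : Fin (N + 1) → ℂ) := by
  ext x
  rw [freeCreation, planeWave, planeWave, ← Complex.exp_add, Fin.sum_univ_castSucc]
  simp only [Fin.snoc_castSucc, Fin.snoc_last, Fin.init]
  congr 1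
  ring

end Creation

/-! ### The integral equation for `P_γ ê⁻_μ`, and the intertwining relation -/

section Intertwining

open Filter Topology

variable {N : ℕ}

/-- The inclusion of the simple transpositions of `N` letters into those of `N + 1` letters. -/
def liftLetter (i : Fin (N - 1)) : Fin (N + 1 - 1) := ⟨i, by omega⟩

theorem init_comp_liftLetter (i : Fin (N - 1)) (y : Fin (N + 1) → ℝ) :
    (Fin.init (y ∘ simpleRefl (liftLetter i)) : Fin N → ℝ) = Fin.init y ∘ simpleRefl i := by
  ext k
  simp only [Fin.init, Function.comp_apply]
  congr 1
  simp only [simpleRefl, liftLetter, Equiv.swap_apply_def, Fin.ext_iff, Fin.val_castSucc]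
  split_ifs <;> rfl

theorem comp_liftLetter_last (i : Fin (N - 1)) (y : Fin (N + 1) → ℝ) :
    (y ∘ simpleRefl (liftLetter i)) (Fin.last N) = y (Fin.last N) := by
  rw [Function.comp_apply, simpleRefl, Equiv.swap_apply_of_ne_of_ne]
  all_goals simp only [ne_eq, Fin.ext_iff, Fin.val_last, liftLetter]; omega

/-- The transposition and the integral move only the first `N` coordinates, so the factor `e^{iμ
x_{N+1}}` passes through. -/
theorem deformedRefl_freeCreation (γ : ℝ) (μ : ℂ) (i : Fin (N - 1)) (f : (Fin N → ℝ) → ℂ) :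
    deformedRefl γ (liftLetter i) (freeCreation μ f) = freeCreation μ (deformedRefl γ i f) := by
  ext x
  have h1 : ∀ y : ℝ, x - y • (Pi.single (⟨liftLetter i, by omega⟩ : Fin (N + 1)) (1 : ℝ) -
      Pi.single ⟨liftLetter i + 1, by omega⟩ 1) = fun k : Fin (N + 1) ↦ (Fin.snoc
        (Fin.init x - y • (Pi.single (⟨i, by omega⟩ : Fin N) (1 : ℝ) -
          Pi.single ⟨i + 1, by omega⟩ 1)) (x (Fin.last N)) : Fin (N + 1) → ℝ) k := by
    intro y
    ext k
    refine Fin.lastCases ?_ (fun k ↦ ?_) k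
    · have h2 : (Fin.last N : Fin (N + 1)) ≠ ⟨liftLetter i, by omega⟩ := by
        simp only [ne_eq, Fin.ext_iff, Fin.val_last, liftLetter]; omega
      have h3 : (Fin.last N : Fin (N + 1)) ≠ ⟨liftLetter i + 1, by omega⟩ := by
        simp only [ne_eq, Fin.ext_iff, Fin.val_last, liftLetter]; omega
      simp [h2, h3]
    · simp only [Pi.sub_apply, Pi.smul_apply, Pi.single_apply, Fin.snoc_castSucc, Fin.ext_iff,
        Fin.val_castSucc, liftLetter, Fin.init]
  simp only [deformedRefl, permAct, intOp, freeCreation, init_comp_liftLetter,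
    comp_liftLetter_last, h1, Fin.init_snoc, Fin.snoc_last]
  rw [intervalIntegral.integral_const_mul, mul_add, mul_left_comm]
  rfl

theorem exists_lift_perm (γ : ℝ) (μ : ℂ) (w : Equiv.Perm (Fin N)) :
    ∃ u : Equiv.Perm (Fin (N + 1)), (∀ f : (Fin N → ℝ) → ℂ, Continuous f →
      deformedPerm γ u (freeCreation μ f) = freeCreation μ (deformedPerm γ w f)) ∧
      ∀ y : Fin (N + 1) → ℝ, (Fin.init (y ∘ u) : Fin N → ℝ) = Fin.init y ∘ w ∧
        (y ∘ u) (Fin.last N) = y (Fin.last N) := by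
  obtain ⟨l, rfl⟩ := exists_word w
  refine ⟨((l.map liftLetter).map simpleRefl).prod, fun f hf ↦ ?_, ?_⟩
  · rw [← wordOp_eq_deformedPerm γ _ hf,
      ← wordOp_eq_deformedPerm γ _ ((contLinOp_freeCreation μ).continuous hf)]
    clear hf
    induction l with
    | nil => rfl
    | cons i l ih =>
      exact (congrArg (deformedRefl γ (liftLetter i)) ih).trans
        (deformedRefl_freeCreation γ μ i _)
  · induction l with
    | nil => exact fun y ↦ ⟨rfl, rfl⟩
    | cons i l ih =>
      intro y
      simp only [List.map_cons, List.prod_cons, Equiv.Perm.coe_mul, ← Function.comp_assoc]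
      rw [(ih _).1, (ih _).2, init_comp_liftLetter, comp_liftLetter_last]
      exact ⟨rfl, rfl⟩

/-- When the last coordinate is a smallest one, sorting the others already sorts the whole vector.
This provides the initial value of the equation in `t`. -/
theorem propagation_freeCreation_of_le (γ : ℝ) (μ : ℂ) {f : (Fin N → ℝ) → ℂ} (hf : Continuous f)
    {x : Fin N → ℝ} {t : ℝ} (ht : ∀ i, t ≤ x i) :
    propagation γ (freeCreation μ f) (Fin.snoc x t : Fin (N + 1) → ℝ) =
      Complex.exp (Complex.I * μ * t) * propagation γ f x := by
  have hx := antitone_sortPerm x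
  set w := sortPerm x
  obtain ⟨u, hu, hu'⟩ := exists_lift_perm γ μ w
  set y : Fin (N + 1) → ℝ := Fin.snoc x t with hy
  have h1 : y ∘ ⇑u⁻¹ = (Fin.snoc (x ∘ ⇑w⁻¹) t : Fin (N + 1) → ℝ) := by
    obtain ⟨h2, h3⟩ := hu' (y ∘ ⇑u⁻¹)
    have h4 : (y ∘ ⇑u⁻¹) ∘ ⇑u = y := by ext; simp
    rw [h4] at h2 h3
    rw [← Fin.snoc_init_self (y ∘ ⇑u⁻¹), ← h3]
    have h5 : (Fin.init (y ∘ ⇑u⁻¹) : Fin N → ℝ) = x ∘ ⇑w⁻¹ := by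
      have : (Fin.init y : Fin N → ℝ) = x := Fin.init_snoc (α := fun _ ↦ ℝ) _ _
      rw [← this, h2]
      ext; simp
    rw [h5, hy, Fin.snoc_last]
  have h2 : Antitone (y ∘ ⇑u⁻¹) := by
    rw [h1]
    intro a b hab
    induction b using Fin.lastCases with
    | last =>
      rw [Fin.snoc_last]
      induction a using Fin.lastCases with
      | last => rw [Fin.snoc_last]
      | cast a => rw [Fin.snoc_castSucc]; exact ht _
    | cast b =>
      induction a using Fin.lastCases with
      | last => exact absurd hab (not_le.2 (Fin.castSucc_lt_last b))
      | cast a => rw [Fin.snoc_castSucc, Fin.snoc_castSucc]; exact hx hab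
  rw [propagation_apply γ ((contLinOp_freeCreation μ).continuous hf) h2, hu f hf, h1,
    propagation_apply γ hf hx, freeCreation, Fin.snoc_last, Fin.init_snoc]

theorem partialDeriv_last_freeCreation (μ : ℂ) {f : (Fin N → ℝ) → ℂ} (hf : ContDiff ℝ ∞ f) :
    partialDeriv (Fin.last N) (freeCreation μ f) = (Complex.I * μ) • freeCreation μ f := by
  ext x
  have h1 : HasDerivAt (fun s : ℝ ↦ x + s • Pi.single (Fin.last N) (1 : ℝ))
      (Pi.single (Fin.last N) (1 : ℝ)) 0 := by
    simpa using ((hasDerivAt_id (0 : ℝ)).smul_const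
      (Pi.single (Fin.last N) (1 : ℝ) : Fin (N + 1) → ℝ)).const_add x
  have h2 : DifferentiableAt ℝ (freeCreation μ f) (x + (0 : ℝ) • Pi.single (Fin.last N) (1 : ℝ)) :=
    (contDiff_freeCreation μ hf).differentiable (by simp) _
  have h3 := h2.hasFDerivAt.comp_hasDerivAt 0 h1
  have h4 (s : ℝ) : freeCreation μ f (x + s • Pi.single (Fin.last N) (1 : ℝ)) =
      Complex.exp (Complex.I * μ * (x (Fin.last N) + s)) * f (Fin.init x) := by
    have : (Fin.init (x + s • Pi.single (Fin.last N) (1 : ℝ)) : Fin N → ℝ) = Fin.init x := by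
      ext i; simp [Fin.init]
    rw [freeCreation, this]
    simp
  have h5 : HasDerivAt (fun s : ℝ ↦ Complex.exp (Complex.I * μ * (x (Fin.last N) + s)) *
      f (Fin.init x)) _ 0 :=
    ((((Complex.ofRealCLM.hasDerivAt (x := 0)).const_add (x (Fin.last N) : ℂ)).const_mul
      (Complex.I * μ)).cexp).mul_const _
  have h6 := h3.unique (h5.congr_of_eventuallyEq (.of_forall h4))
  rw [zero_smul, add_zero] at h6
  rw [partialDeriv, h6]
  simp [freeCreation]
  ring

theorem snoc_comp_swap (x : Fin N → ℝ) (t : ℝ) (i : Fin N) :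
    (Fin.snoc x t : Fin (N + 1) → ℝ) ∘ Equiv.swap (Fin.last N) i.castSucc =
      (Fin.snoc (Function.update x i t) (x i) : Fin (N + 1) → ℝ) := by
  ext k
  rw [Function.comp_apply]
  induction k using Fin.lastCases with
  | last => rw [Equiv.swap_apply_left, Fin.snoc_castSucc, Fin.snoc_last]
  | cast k =>
    rcases eq_or_ne k i with rfl | hk
    · simp
    · rw [Equiv.swap_apply_of_ne_of_ne (Fin.castSucc_lt_last k).ne
        ((Fin.castSucc_injective N).ne hk)]
      simp [hk]

theorem eventually_antitone_snoc {x : Fin N → ℝ} {t : ℝ} (ht : ∀ i, x i ≠ t)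
    {w : Equiv.Perm (Fin (N + 1))} (hw : Antitone ((Fin.snoc x t : Fin (N + 1) → ℝ) ∘ ⇑w⁻¹)) :
    ∀ᶠ s in 𝓝 t, Antitone ((Fin.snoc x s : Fin (N + 1) → ℝ) ∘ ⇑w⁻¹) := by
  have key : ∀ᶠ s in 𝓝 t, ∀ a b : Fin (N + 1), (Fin.snoc x t : Fin (N + 1) → ℝ) b ≤
      (Fin.snoc x t : Fin (N + 1) → ℝ) a →
      (Fin.snoc x s : Fin (N + 1) → ℝ) b ≤ (Fin.snoc x s : Fin (N + 1) → ℝ) a := by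
    simp only [eventually_all]
    intro a b hab
    induction a using Fin.lastCases with
    | last =>
      induction b using Fin.lastCases with
      | last => exact .of_forall fun s ↦ le_rfl
      | cast b =>
        simp only [Fin.snoc_last, Fin.snoc_castSucc] at hab ⊢
        exact (lt_mem_nhds (lt_of_le_of_ne hab (ht b))).mono fun s hs ↦ hs.le
    | cast a =>
      induction b using Fin.lastCases with
      | last =>
        simp only [Fin.snoc_last, Fin.snoc_castSucc] at hab ⊢
        exact (gt_mem_nhds (lt_of_le_of_ne hab (ht a).symm)).mono fun s hs ↦ hs.le
      | cast b =>
        simp only [Fin.snoc_castSucc] at hab ⊢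
        exact .of_forall fun s ↦ hab
  filter_upwards [key] with s hs a b hab
  exact hs _ _ (hw hab)

/-- Near `t` a fixed `w` sorts the vector, so `partialDeriv_deformedPerm` applies in direction `w
(last)`. The inversion coefficients become the conditions `x_i < t`, and each term `(j k) w` is the
propagation at the point with `t` and `x_i` exchanged. Ties among the `x_i` are allowed because the
formula for `P_γ` holds on closed chambers. -/
theorem hasDerivAt_propagation_freeCreation (γ : ℝ) (μ : ℂ) {f : (Fin N → ℝ) → ℂ}
    (hf : ContDiff ℝ ∞ f) {x : Fin N → ℝ} {t : ℝ} (ht : ∀ i, x i ≠ t) :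
    HasDerivAt (fun s ↦ propagation γ (freeCreation μ f) (Fin.snoc x s : Fin (N + 1) → ℝ))
      (Complex.I * μ * propagation γ (freeCreation μ f) (Fin.snoc x t : Fin (N + 1) → ℝ) +
        γ * ∑ i, if x i < t then propagation γ (freeCreation μ f)
          (Fin.snoc (Function.update x i t) (x i) : Fin (N + 1) → ℝ) else 0) t := by
  set g := freeCreation μ f
  have hg : ContDiff ℝ ∞ g := contDiff_freeCreation μ hf
  set y : Fin (N + 1) → ℝ := Fin.snoc x t with hy
  have hw := antitone_sortPerm y
  set w := sortPerm y
  have h1 : (fun s ↦ propagation γ g (Fin.snoc x s : Fin (N + 1) → ℝ)) =ᶠ[𝓝 t]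
      fun s ↦ deformedPerm γ w g ((Fin.snoc x s : Fin (N + 1) → ℝ) ∘ ⇑w⁻¹) := by
    filter_upwards [eventually_antitone_snoc ht hw] with s hs
    exact propagation_apply γ hg.continuous hs
  have h2 : HasDerivAt (fun s ↦ (Fin.snoc x s : Fin (N + 1) → ℝ) ∘ ⇑w⁻¹)
      (Pi.single (w (Fin.last N)) 1) t := by
    rw [hasDerivAt_pi]
    intro k
    rcases eq_or_ne (w⁻¹ k) (Fin.last N) with hk | hk
    · have hk' : k = w (Fin.last N) := by rw [← hk]; simp
      simp only [Function.comp_apply, hk, Fin.snoc_last]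
      rw [hk', Pi.single_eq_same]
      exact hasDerivAt_id t
    · have hk' : k ≠ w (Fin.last N) := by rintro rfl; simp at hk
      rw [Pi.single_eq_of_ne hk']
      obtain ⟨m, hm⟩ := Fin.exists_castSucc_eq.2 hk
      simp only [Function.comp_apply, ← hm, Fin.snoc_castSucc]
      exact hasDerivAt_const _ _
  have h3 := ((contDiff_deformedPerm γ w hg).differentiable (by simp) (y ∘ ⇑w⁻¹)
    ).hasFDerivAt.comp_hasDerivAt t h2
  refine (h3.congr_of_eventuallyEq h1).congr_deriv ?_
  have h4 := congrFun (partialDeriv_deformedPerm γ w (w (Fin.last N)) hg) (y ∘ ⇑w⁻¹)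
  rw [partialDeriv] at h4
  have hinv (k : Fin (N + 1)) : w⁻¹ (w k) = k := by simp
  rw [h4, hinv, partialDeriv_last_freeCreation μ hf]
  have h5 : deformedPerm γ w ((Complex.I * μ) • g) = (Complex.I * μ) • deformedPerm γ w g :=
    (contLinOp_deformedPerm γ w).map_smul _ _ hg.continuous
  rw [Pi.add_apply, h5, Pi.smul_apply, Pi.smul_apply, ← propagation_apply γ hg.continuous hw,
    Finset.sum_apply, ← Equiv.sum_comp w, Fin.sum_univ_castSucc]
  simp only [smul_eq_mul, Pi.smul_apply]
  congr 2
  have h6 : inversionCoeff w (w (Fin.last N)) (w (Fin.last N)) = 0 := by simp [inversionCoeff]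
  rw [h6, zero_mul, add_zero]
  refine Finset.sum_congr rfl fun i _ ↦ ?_
  have h7 : inversionCoeff w (w (Fin.last N)) (w i.castSucc) = if x i < t then 1 else 0 := by
    have hlast : (y ∘ ⇑w⁻¹) (w (Fin.last N)) = t := by simp [hy]
    have hi : (y ∘ ⇑w⁻¹) (w i.castSucc) = x i := by simp [hy]
    have h8 : w (Fin.last N) < w i.castSucc ↔ x i < t := by
      constructor
      · intro h
        have h9 := hw h.le
        rw [hlast, hi] at h9
        exact lt_of_le_of_ne h9 (ht i)
      · intro h
        by_contra h9
        have h10 := hw (not_lt.1 h9)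
        rw [hlast, hi] at h10
        exact absurd h (not_lt.2 h10)
    rw [inversionCoeff, hinv, hinv,
      if_neg (not_lt.2 (Fin.le_last _)), sub_zero]
    simp only [h8]
  have h8 : propagation γ g (Fin.snoc (Function.update x i t) (x i) : Fin (N + 1) → ℝ) =
      deformedPerm γ (Equiv.swap (w (Fin.last N)) (w i.castSucc) * w) g (y ∘ ⇑w⁻¹) := by
    rw [← snoc_comp_swap, ← Equiv.mul_swap_eq_swap_mul]
    have h9 : (y ∘ Equiv.swap (Fin.last N) i.castSucc) ∘
        ⇑(w * Equiv.swap (Fin.last N) i.castSucc)⁻¹ = y ∘ ⇑w⁻¹ := by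
      ext k
      simp [mul_inv_rev]
    rw [propagation_apply γ hg.continuous (w := w * Equiv.swap (Fin.last N) i.castSucc), h9]
    rw [h9]
    exact hw
  rw [h7, h8, ite_mul, one_mul, zero_mul]

theorem hasDerivAt_integral_max {g : ℝ → ℂ} (hg : Continuous g) {a t : ℝ} (h : a ≠ t) :
    HasDerivAt (fun s ↦ ∫ y in a..(max s a), g y) (if a < t then g t else 0) t := by
  rcases lt_or_gt_of_ne h with h | h
  · rw [if_pos h]
    refine (intervalIntegral.integral_hasDerivAt_right (hg.intervalIntegrable a t)
      (hg.stronglyMeasurableAtFilter _ _) hg.continuousAt).congr_of_eventuallyEq ?_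
    filter_upwards [lt_mem_nhds h] with s hs
    rw [max_eq_left hs.le]
  · rw [if_neg (not_lt.2 h.le)]
    refine (hasDerivAt_const t (0 : ℂ)).congr_of_eventuallyEq ?_
    filter_upwards [gt_mem_nhds h] with s hs
    rw [max_eq_right (le_of_lt hs), intervalIntegral.integral_same]

theorem propagation_freeCreation_recursion (γ : ℝ) (μ : ℂ) {f : (Fin N → ℝ) → ℂ}
    (hf : ContDiff ℝ ∞ f) (x : Fin N → ℝ) (t : ℝ) :
    propagation γ (freeCreation μ f) (Fin.snoc x t : Fin (N + 1) → ℝ) =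
      Complex.exp (Complex.I * μ * t) * propagation γ f x +
      γ * ∑ i, ∫ y in (x i)..(max t (x i)), Complex.exp (Complex.I * μ * ((t : ℂ) - y)) *
        propagation γ (freeCreation μ f)
          (Fin.snoc (Function.update x i y) (x i) : Fin (N + 1) → ℝ) := by
  set F := propagation γ (freeCreation μ f) with hF
  have hFc : Continuous F :=
    (contLinOp_propagation γ).continuous (contDiff_freeCreation μ hf).continuous
  let e (s : ℝ) : ℂ := Complex.exp (-(Complex.I * μ * s))
  have he : Continuous e := by fun_prop
  have hed (s : ℝ) : HasDerivAt e (e s * -(Complex.I * μ)) s := by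
    have := ((Complex.ofRealCLM.hasDerivAt (x := s)).const_mul (Complex.I * μ)).neg.cexp
    simpa using this
  have hsnoc : Continuous fun s : ℝ ↦ (Fin.snoc x s : Fin (N + 1) → ℝ) :=
    Continuous.finSnoc (A := fun _ ↦ ℝ) continuous_const continuous_id
  have hupd (i : Fin N) : Continuous fun y : ℝ ↦
      (Fin.snoc (Function.update x i y) (x i) : Fin (N + 1) → ℝ) :=
    Continuous.finSnoc (A := fun _ ↦ ℝ) (by fun_prop) continuous_const
  let G (i : Fin N) (y : ℝ) : ℂ :=
    e y * F (Fin.snoc (Function.update x i y) (x i) : Fin (N + 1) → ℝ)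
  have hG (i : Fin N) : Continuous (G i) := he.mul (hFc.comp (hupd i))
  -- With the integrating factor `e^{-iμs}`, the integral equation says that `Ψ` is constant. Its
  -- derivative is zero off the finitely many values `x_i`, and continuity bridges these.
  let Ψ (s : ℝ) : ℂ := e s * F (Fin.snoc x s : Fin (N + 1) → ℝ) -
    γ * ∑ i, ∫ y in (x i)..(max s (x i)), G i y
  have hΨ : Continuous Ψ := by
    refine (he.mul (hFc.comp hsnoc)).sub (continuous_const.mul
      (continuous_finsetSum _ fun i _ ↦ ?_))
    exact intervalIntegral.continuous_parametric_intervalIntegral_of_continuous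
      (f := fun _ : ℝ ↦ G i) ((hG i).comp continuous_snd) (by fun_prop)
  have hΨ' (s : ℝ) (hs : ∀ i, x i ≠ s) : HasDerivAt Ψ 0 s := by
    have h1 := (hed s).mul (hasDerivAt_propagation_freeCreation γ μ hf hs)
    have h2 := h1.sub ((HasDerivAt.fun_sum (u := Finset.univ) fun i _ ↦
      hasDerivAt_integral_max (hG i) (hs i)).const_mul (γ : ℂ))
    refine h2.congr_deriv ?_
    simp only [G, ← mul_ite_zero, ← Finset.mul_sum, ← hF]
    ring
  -- Below all `x_i` every integral is empty, so `Ψ` equals `P_γ f` at `x` there.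
  obtain ⟨t₀, ht₀⟩ : ∃ t₀ : ℝ, ∀ i, t₀ ≤ x i := (Set.finite_range x).bddBelow.imp
    fun a ha i ↦ ha ⟨i, rfl⟩
  have h1 := MeasureTheory.integral_eq_of_hasDerivAt_off_countable Ψ (fun _ ↦ 0) (a := t₀) (b := t)
    (Set.finite_range x).countable hΨ.continuousOn
    (fun s hs ↦ hΨ' s fun i hi ↦ hs.2 ⟨i, hi⟩) intervalIntegrable_const
  rw [intervalIntegral.integral_zero, eq_comm, sub_eq_zero] at h1
  have hexp (s : ℝ) : Complex.exp (Complex.I * μ * s) * e s = 1 := by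
    rw [← Complex.exp_add, add_neg_cancel, Complex.exp_zero]
  have h2 : Ψ t₀ = propagation γ f x := by
    simp only [Ψ, max_eq_right (ht₀ _), intervalIntegral.integral_same, Finset.sum_const_zero,
      mul_zero, sub_zero]
    rw [hF, propagation_freeCreation_of_le γ μ hf.continuous ht₀, ← mul_assoc, mul_comm (e t₀),
      hexp, one_mul]
  have h3 (i : Fin N) : ∫ y in (x i)..(max t (x i)), Complex.exp (Complex.I * μ * ((t : ℂ) - y)) *
      F (Fin.snoc (Function.update x i y) (x i) : Fin (N + 1) → ℝ) =
        Complex.exp (Complex.I * μ * t) * ∫ y in (x i)..(max t (x i)), G i y := by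
    rw [← intervalIntegral.integral_const_mul]
    refine intervalIntegral.integral_congr fun y _ ↦ ?_
    simp only [G, e]
    rw [← mul_assoc, ← Complex.exp_add]
    congr 2
    ring
  simp_rw [h3]
  rw [← h2, ← h1, ← Finset.mul_sum]
  linear_combination (-F (Fin.snoc x t : Fin (N + 1) → ℝ)) * hexp t

theorem propagation_freeCreation (γ : ℝ) (μ : ℂ) {f : (Fin N → ℝ) → ℂ} (hf : Continuous f) :
    propagation γ (freeCreation μ f) = creation γ μ (propagation γ f) := by
  refine ((contLinOp_propagation γ).comp (contLinOp_freeCreation μ)).eq_of_planeWave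
    ((contLinOp_creation γ μ).comp (contLinOp_propagation γ)) (fun lam ↦ ?_) hf
  have hsm := contDiff_planeWave fun j ↦ (lam j : ℂ)
  ext x
  rw [creation_apply]
  nth_rewrite 1 [← Fin.snoc_init_self x]
  exact eq_of_creation_recursion γ μ
    (F := fun x t ↦ propagation γ (freeCreation μ _) (Fin.snoc x t : Fin (N + 1) → ℝ))
    (propagation_freeCreation_recursion γ μ hsm)
    (creationAt_recursion γ μ ((contLinOp_propagation γ).continuous hsm.continuous)) _ _

end Intertwining

end QNLS

theorem mainTheorem10 (N : ℕ) (γ : ℝ) (μ : ℂ) :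
    -- the deformed permutations do not depend on the chosen decompositions
    (∀ (n : ℕ) (l : List (Fin (n - 1))) (f : (Fin n → ℝ) → ℂ), Continuous f →
      QNLS.wordOp γ l f = QNLS.deformedPerm γ (l.map QNLS.simpleRefl).prod f) ∧
    -- the four operators are linear maps between spaces of continuous functions, and intertwine
    (∃ (P : C(Fin N → ℝ, ℂ) →ₗ[ℂ] C(Fin N → ℝ, ℂ))
        (P' : C(Fin (N + 1) → ℝ, ℂ) →ₗ[ℂ] C(Fin (N + 1) → ℝ, ℂ))
        (E B : C(Fin N → ℝ, ℂ) →ₗ[ℂ] C(Fin (N + 1) → ℝ, ℂ)),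
      (∀ f, ⇑(P f) = QNLS.propagation γ ⇑f) ∧
      (∀ g, ⇑(P' g) = QNLS.propagation γ ⇑g) ∧
      (∀ f, ⇑(E f) = QNLS.freeCreation μ ⇑f) ∧
      (∀ f, ⇑(B f) = QNLS.creation γ μ ⇑f) ∧
      P' ∘ₗ E = B ∘ₗ P) ∧
    -- in particular, the intertwining relation on `CB^∞(ℝ^N)`
    (∀ f ∈ QNLS.CBSmooth N,
      QNLS.freeCreation μ f ∈ QNLS.CBSmooth (N + 1) ∧
      QNLS.propagation γ (QNLS.freeCreation μ f) =
        QNLS.creation γ μ (QNLS.propagation γ f)) ∧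
    -- for smooth `f`, the functions involved lie in `CB^∞`
    (∀ f : (Fin N → ℝ) → ℂ, ContDiff ℝ ∞ f →
      QNLS.propagation γ f ∈ QNLS.CBSmooth N ∧
      QNLS.propagation γ (QNLS.freeCreation μ f) ∈ QNLS.CBSmooth (N + 1) ∧
      QNLS.creation γ μ (QNLS.propagation γ f) ∈ QNLS.CBSmooth (N + 1)) ∧
    -- on plane waves both sides are the pre-wavefunction
    (∀ lam : Fin N → ℂ,
      QNLS.propagation γ (QNLS.freeCreation μ (QNLS.planeWave lam)) =
        QNLS.preWave γ (Fin.snoc lam μ : Fin (N + 1) → ℂ) ∧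
      QNLS.creation γ μ (QNLS.propagation γ (QNLS.planeWave lam)) =
        QNLS.preWave γ (Fin.snoc lam μ : Fin (N + 1) → ℂ)) := by
  have hP {n : ℕ} := QNLS.contLinOp_propagation (n := n) γ
  have hE := QNLS.contLinOp_freeCreation (N := N) μ
  have hB := QNLS.contLinOp_creation (N := N) γ μ
  have key {f : (Fin N → ℝ) → ℂ} (hf : Continuous f) := QNLS.propagation_freeCreation γ μ hf
  refine ⟨fun n l f hf ↦ QNLS.wordOp_eq_deformedPerm γ l hf,
    ⟨hP.toLinearMap, hP.toLinearMap, hE.toLinearMap, hB.toLinearMap, fun _ ↦ rfl, fun _ ↦ rfl,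
      fun _ ↦ rfl, fun _ ↦ rfl, ?_⟩,
    fun f hf ↦ ⟨QNLS.freeCreation_mem_CBSmooth μ hf, key hf.1⟩, fun f hf ↦ ?_, fun lam ↦ ?_⟩
  · ext f x
    exact congrFun (key f.continuous) x
  -- Smoothness of `b⁻_μ P_γ f` on regular vectors is read off from the other side of the
  -- intertwining relation, where `ê⁻_μ f` is smooth.
  · have h := QNLS.propagation_mem_CBSmooth γ (QNLS.contDiff_freeCreation μ hf)
    exact ⟨QNLS.propagation_mem_CBSmooth γ hf, h, key hf.continuous ▸ h⟩
  · rw [← key (QNLS.contDiff_planeWave lam).continuous, QNLS.freeCreation_planeWave]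
    exact ⟨rfl, rfl⟩
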